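/- Let $\Bbbk$ be a field and let $Q_A$, $Q_B$ be finite quivers. Paths are composed from left to right, and $J_Q$ denotes the ideal of the path algebra $\Bbbk Q$ generated by the arrows. Let $I_A \subseteq \Bbbk Q_A$ and $I_B \subseteq \Bbbk Q_B$ be admissible ideals, i.e. $J_Q^m \subseteq I \subseteq J_Q^2$ for some $m \ge 2$, and let $A = \Bbbk Q_A/I_A$, $B = \Bbbk Q_B/I_B$. Let $Q_C$ be the quiver whose set of vertices is the disjoint union of the vertices of $Q_A$ and of $Q_B$, and whose arrows are the arrows of $Q_A$, the arrows of $Q_B$, a finite family of arrows $(\alpha_j)_{j\in J}$, each starting at a vertex of $Q_A$ and ending at a vertex of $Q_B$, and a finite family of arrows $(\beta_k)_{k\in K}$, each starting at a vertex of $Q_B$ and ending at a vertex of $Q_A$. Let $C = \Bbbk Q_C/I_C$, where $I_C$ is the two-sided ideal $$I_C = \langle\, I_A,\ I_B,\ \alpha\alpha_j,\ \beta\beta_k,\ \alpha_j\beta_k,\ \beta_k\alpha_j \;:\; \alpha \in (Q_A)_1,\ \beta\in (Q_B)_1,\ j\in J,\ k\in K \,\rangle .$$ Modules are finitely generated right modules.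 For a class $\mathcal X$ of modules let $\operatorname{findim}(\mathcal X)$ be the supremum of the projective dimensions of those modules in $\mathcal X$ that have finite projective dimension; for an algebra $\Lambda$ let $\operatorname{findim}(\Lambda) = \operatorname{findim}(\operatorname{mod}\Lambda)$, and let $\operatorname{findim}(\Lambda_0)$ be $\operatorname{findim}$ of the class of all finitely generated semisimple $\Lambda$-modules. If $\operatorname{findim}(A^{op}) < \infty$ and $\operatorname{findim}(B^{op}) < \infty$, then $\operatorname{findim}(C^{op}) < \infty$, and $$\operatorname{findim}(C^{op}) \le \max\{\operatorname{findim}(A^{op}),\ \operatorname{findim}(B^{op}),\ \operatorname{findim}((C^{op})_0)\} + 1 .$$ -/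

import Mathlib

universe u

noncomputable section

/-! ### The path algebra of a quiver -/

/-- All paths of a quiver `V`, each together with its start and its target. -/
abbrev QuiverPath (V : Type u) [Quiver.{u} V] : Type u :=
  Σ a b : V, Quiver.Path a b

/-- The underlying vector space of the path algebra `k V`: the paths of `V` form a basis. -/
def PathAlgebra (k V : Type u) [Field k] [Quiver.{u} V] : Type u :=
  QuiverPath V →₀ k

namespace PathAlgebra

variable {k V : Type u} [Field k] [Quiver.{u} V]

instance : AddCommGroup (PathAlgebra k V) :=
  inferInstanceAs (AddCommGroup (QuiverPath V →₀ k))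

instance : Module k (PathAlgebra k V) :=
  inferInstanceAs (Module k (QuiverPath V →₀ k))

/-- The basis vector given by a path. -/
def ofPath {a b : V} (p : Quiver.Path a b) : PathAlgebra k V :=
  Finsupp.single (⟨a, b, p⟩ : QuiverPath V) (1 : k)

/-- The basis vector given by an arrow. -/
def ofArrow {a b : V} (f : a ⟶ b) : PathAlgebra k V :=
  ofPath f.toPath

open Classical in
/-- The product of two paths: their concatenation, first `p` and then `q` (paths are composed
from left to right), if the target of `p` is the start of `q`, and `0` otherwise. -/
def mulPath (p q : QuiverPath V) : PathAlgebra k V :=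
  if h : q.1 = p.2.1 then ofPath (p.2.2.comp (q.2.2.cast h rfl)) else 0

/-- The bilinear extension of the product of paths. -/
def mulLin : PathAlgebra k V →ₗ[k] PathAlgebra k V →ₗ[k] PathAlgebra k V :=
  Finsupp.linearCombination k fun p : QuiverPath V =>
    (Finsupp.linearCombination k fun q : QuiverPath V => mulPath (k := k) p q :
      PathAlgebra k V →ₗ[k] PathAlgebra k V)

instance : Mul (PathAlgebra k V) := ⟨fun x y => mulLin x y⟩

theorem mul_def (x y : PathAlgebra k V) : x * y = mulLin x y := rfl

theorem induction_linear {P : PathAlgebra k V → Prop} (x : PathAlgebra k V) (h0 : P 0)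
    (hadd : ∀ y z, P y → P z → P (y + z))
    (hpath : ∀ (c : k) (a b : V) (p : Quiver.Path a b), P (c • ofPath p)) : P x := by
  refine Finsupp.induction_linear (motive := P) x h0 hadd ?_
  rintro ⟨a, b, p⟩ c
  have h := hpath c a b p
  have e : (c • ofPath p : PathAlgebra k V) =
      Finsupp.single (⟨a, b, p⟩ : QuiverPath V) c := by
    change c • Finsupp.single (⟨a, b, p⟩ : QuiverPath V) (1 : k) = _
    rw [Finsupp.smul_single, smul_eq_mul, mul_one]
  rwa [e] at h

theorem mulLin_ofPath {a b c d : V} (p : Quiver.Path a b) (q : Quiver.Path c d) :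
    mulLin (ofPath p : PathAlgebra k V) (ofPath q) = mulPath ⟨a, b, p⟩ ⟨c, d, q⟩ := by
  have h1 : mulLin (ofPath p : PathAlgebra k V) =
      (Finsupp.linearCombination k fun q : QuiverPath V =>
        mulPath (k := k) ⟨a, b, p⟩ q : PathAlgebra k V →ₗ[k] PathAlgebra k V) := by
    refine (Finsupp.linearCombination_single (R := k) 1 (⟨a, b, p⟩ : QuiverPath V)).trans ?_
    exact one_smul k _
  rw [h1]
  refine (Finsupp.linearCombination_single (R := k) 1 (⟨c, d, q⟩ : QuiverPath V)).trans ?_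
  exact one_smul k _

/-- Composable paths are multiplied by concatenation. -/
theorem ofPath_mul_ofPath {a b c : V} (p : Quiver.Path a b) (q : Quiver.Path b c) :
    (ofPath p * ofPath q : PathAlgebra k V) = ofPath (p.comp q) := by
  rw [mul_def, mulLin_ofPath, mulPath, dif_pos rfl]
  rfl

/-- The product of two paths that are not composable is zero. -/
theorem ofPath_mul_ofPath_of_ne {a b c d : V} (p : Quiver.Path a b) (q : Quiver.Path c d)
    (h : c ≠ b) : (ofPath p * ofPath q : PathAlgebra k V) = 0 := by
  rw [mul_def, mulLin_ofPath, mulPath, dif_neg h]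

theorem mulLin_assoc (x y z : PathAlgebra k V) :
    mulLin (mulLin x y) z = mulLin x (mulLin y z) := by
  induction x using induction_linear with
  | h0 => simp
  | hadd x x' hx hx' => simp [hx, hx']
  | hpath r a b p =>
    induction y using induction_linear with
    | h0 => simp
    | hadd y y' hy hy' => simp only [map_add, LinearMap.add_apply, hy, hy']
    | hpath s c d q =>
      induction z using induction_linear with
      | h0 => simp
      | hadd z z' hz hz' => simp only [map_add, hz, hz']
      | hpath t e f w =>
        simp only [map_smul, LinearMap.smul_apply]
        congr 3
        simp only [← mul_def]
        by_cases h1 : c = b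
        · subst h1
          by_cases h2 : e = d
          · subst h2
            simp only [ofPath_mul_ofPath, Quiver.Path.comp_assoc]
          · rw [ofPath_mul_ofPath_of_ne q w h2, ofPath_mul_ofPath,
              ofPath_mul_ofPath_of_ne _ _ h2]
            simp [mul_def]
        · rw [ofPath_mul_ofPath_of_ne p q h1]
          by_cases h2 : e = d
          · subst h2
            rw [ofPath_mul_ofPath, ofPath_mul_ofPath_of_ne _ _ h1]
            simp [mul_def]
          · rw [ofPath_mul_ofPath_of_ne q w h2]
            simp [mul_def]

/-- The linear map between path algebras that sends a path to its image under a morphism of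
quivers. -/
def mapQuiver {W : Type u} [Quiver.{u} W] (φ : V ⥤q W) :
    PathAlgebra k V →ₗ[k] PathAlgebra k W :=
  Finsupp.lmapDomain k k fun p : QuiverPath V =>
    (⟨φ.obj p.1, φ.obj p.2.1, φ.mapPath p.2.2⟩ : QuiverPath W)

theorem mapQuiver_ofPath {W : Type u} [Quiver.{u} W] (φ : V ⥤q W) {a b : V}
    (p : Quiver.Path a b) :
    mapQuiver φ (ofPath p : PathAlgebra k V) = ofPath (φ.mapPath p) :=
  Finsupp.mapDomain_single

variable (k V) in
/-- The power `J ^ m` of the ideal `J` generated by the arrows: the span of all paths of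
length at least `m`. -/
def arrowIdealPow (m : ℕ) : Submodule k (PathAlgebra k V) :=
  Submodule.span k {x | ∃ (a b : V) (p : Quiver.Path a b), m ≤ p.length ∧ x = ofPath p}

variable [Fintype V]

/-- The unit of the path algebra is the sum of the trivial paths. -/
instance : One (PathAlgebra k V) := ⟨∑ v : V, ofPath (Quiver.Path.nil : Quiver.Path v v)⟩

theorem one_def :
    (1 : PathAlgebra k V) = ∑ v : V, ofPath (Quiver.Path.nil : Quiver.Path v v) := rfl

theorem mulLin_one_left (x : PathAlgebra k V) : mulLin 1 x = x := by
  induction x using induction_linear with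
  | h0 => simp
  | hadd x y hx hy => rw [map_add, hx, hy]
  | hpath r a b p =>
    rw [map_smul]
    congr 1
    rw [one_def, map_sum, LinearMap.sum_apply, Finset.sum_eq_single a]
    · rw [← mul_def, ofPath_mul_ofPath, Quiver.Path.nil_comp]
    · intro v _ hv
      exact ofPath_mul_ofPath_of_ne _ _ hv.symm
    · simp

theorem mulLin_one_right (x : PathAlgebra k V) : mulLin x 1 = x := by
  induction x using induction_linear with
  | h0 => simp
  | hadd x y hx hy => rw [map_add, LinearMap.add_apply, hx, hy]
  | hpath r a b p =>
    rw [map_smul, LinearMap.smul_apply]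
    congr 1
    rw [one_def, map_sum, Finset.sum_eq_single b]
    · rw [← mul_def, ofPath_mul_ofPath, Quiver.Path.comp_nil]
    · intro v _ hv
      exact ofPath_mul_ofPath_of_ne _ _ hv
    · simp

instance : Ring (PathAlgebra k V) where
  __ := (inferInstance : AddCommGroup (PathAlgebra k V))
  mul := (· * ·)
  one := 1
  mul_assoc := mulLin_assoc
  one_mul := mulLin_one_left
  mul_one := mulLin_one_right
  left_distrib x y z := map_add (mulLin x) y z
  right_distrib x y z := by
    change mulLin (x + y) z = mulLin x z + mulLin y z
    rw [map_add, LinearMap.add_apply]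
  zero_mul x := by
    change mulLin 0 x = 0
    rw [map_zero, LinearMap.zero_apply]
  mul_zero x := map_zero (mulLin x)

instance : Algebra k (PathAlgebra k V) :=
  Algebra.ofModule
    (fun r x y => by
      change mulLin (r • x) y = r • mulLin x y
      rw [map_smul, LinearMap.smul_apply])
    (fun r x y => map_smul (mulLin x) r y)

end PathAlgebra

/-! ### Bound quiver algebras -/

section BoundQuiver

variable {k V : Type u} [Field k] [Quiver.{u} V] [Fintype V]

/-- A two-sided ideal `I` of the path algebra is admissible if `J ^ m ⊆ I ⊆ J ^ 2` for some
`m ≥ 2`, where `J` is the ideal generated by the arrows. -/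
def IsAdmissible (I : TwoSidedIdeal (PathAlgebra k V)) : Prop :=
  (∀ x ∈ I, x ∈ PathAlgebra.arrowIdealPow k V 2) ∧
    ∃ m : ℕ, 2 ≤ m ∧ ∀ x ∈ PathAlgebra.arrowIdealPow k V m, x ∈ I

/-- The quotient `k V / I` of the path algebra by a two-sided ideal. -/
abbrev BoundQuiverAlgebra (I : TwoSidedIdeal (PathAlgebra k V)) : Type u :=
  I.ringCon.Quotient

end BoundQuiver

/-! ### Gluing two quivers along arrows in both directions -/

/-- The vertices of the glued quiver: the disjoint union of the vertices of `V` and of `W`.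
Here `J a b` is the set of new arrows from `a` in `V` to `b` in `W`, and `K b a` is the set of
new arrows from `b` in `W` to `a` in `V`. -/
inductive Glue {V W : Type u} (J : V → W → Type u) (K : W → V → Type u) : Type u
  | inl (a : V) : Glue J K
  | inr (b : W) : Glue J K

namespace Glue

variable {V W : Type u} {J : V → W → Type u} {K : W → V → Type u}

/-- The vertices of the glued quiver as a sum type. -/
def equivSum : Glue J K ≃ V ⊕ W where
  toFun
    | inl a => Sum.inl a
    | inr b => Sum.inr b
  invFun
    | Sum.inl a => inl a
    | Sum.inr b => inr b
  left_inv x := by cases x <;> rfl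
  right_inv x := by cases x <;> rfl

instance [Fintype V] [Fintype W] : Fintype (Glue J K) :=
  Fintype.ofEquiv (V ⊕ W) equivSum.symm

variable [Quiver.{u} V] [Quiver.{u} W]

/-- The arrows of the glued quiver: those of `V`, those of `W`, the arrows `α` from `V` to `W`
in the family `J`, and the arrows `β` from `W` to `V` in the family `K`. -/
inductive Arrow : Glue J K → Glue J K → Type u
  | left {a a' : V} (f : a ⟶ a') : Arrow (inl a) (inl a')
  | right {b b' : W} (g : b ⟶ b') : Arrow (inr b) (inr b')
  | alpha {a : V} {b : W} (j : J a b) : Arrow (inl a) (inr b)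
  | beta {b : W} {a : V} (l : K b a) : Arrow (inr b) (inl a)

instance : Quiver.{u} (Glue J K) := ⟨Arrow⟩

variable (J K)

/-- The inclusion of the quiver `V`. -/
def inclLeft : V ⥤q Glue J K where
  obj := inl
  map f := Arrow.left f

/-- The inclusion of the quiver `W`. -/
def inclRight : W ⥤q Glue J K where
  obj := inr
  map g := Arrow.right g

variable {J K}
variable (k : Type u) [Field k]

/-- An arrow of the glued quiver as an element of the path algebra. -/
def arrow {x y : Glue J K} (f : Arrow x y) : PathAlgebra k (Glue J K) :=
  PathAlgebra.ofArrow (show x ⟶ y from f)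

variable [Fintype V] [Fintype W]
variable {k}
variable (J K)

/-- The generators of the ideal of relations of the glued algebra: the elements of the ideals
`IA` and `IB`, and the products of arrows `α α_j`, `β β_l`, `α_j β_l` and `β_l α_j`, where `α` is
an arrow of `V`, `β` an arrow of `W`, `α_j` an arrow in the family `J` and `β_l` an arrow in the
family `K`. (The product is zero already in the path algebra if two arrows do not compose.) -/
inductive IsRelation (IA : TwoSidedIdeal (PathAlgebra k V))
    (IB : TwoSidedIdeal (PathAlgebra k W)) : PathAlgebra k (Glue J K) → Prop
  | ofLeft (x : PathAlgebra k V) (hx : x ∈ IA) :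
      IsRelation IA IB (PathAlgebra.mapQuiver (inclLeft J K) x)
  | ofRight (y : PathAlgebra k W) (hy : y ∈ IB) :
      IsRelation IA IB (PathAlgebra.mapQuiver (inclRight J K) y)
  | left_alpha {a a' a'' : V} {b : W} (f : a ⟶ a') (j : J a'' b) :
      IsRelation IA IB (arrow k (Arrow.left f) * arrow k (Arrow.alpha j))
  | right_beta {b b' b'' : W} {a : V} (g : b ⟶ b') (l : K b'' a) :
      IsRelation IA IB (arrow k (Arrow.right g) * arrow k (Arrow.beta l))
  | alpha_beta {a a' : V} {b b' : W} (j : J a b) (l : K b' a') :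
      IsRelation IA IB (arrow k (Arrow.alpha j) * arrow k (Arrow.beta l))
  | beta_alpha {a a' : V} {b b' : W} (l : K b a) (j : J a' b') :
      IsRelation IA IB (arrow k (Arrow.beta l) * arrow k (Arrow.alpha j))

/-- The ideal of relations of the glued algebra. -/
def ideal (IA : TwoSidedIdeal (PathAlgebra k V)) (IB : TwoSidedIdeal (PathAlgebra k W)) :
    TwoSidedIdeal (PathAlgebra k (Glue J K)) :=
  TwoSidedIdeal.span {x | IsRelation J K IA IB x}

end Glue

/-! ### Finitistic dimension -/

section Findim

/-- The finitistic dimension of a class `P` of modules: the supremum of the projective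
dimensions of those modules in `P` that have finite projective dimension. (The zero module, whose
projective dimension is `⊥` in Mathlib, contributes `0`.) -/
def findimOf {R : Type u} [Ring R] (P : ModuleCat.{u} R → Prop) : ℕ∞ :=
  ⨆ (M : ModuleCat.{u} R) (_ : P M) (_ : CategoryTheory.projectiveDimension M ≠ ⊤),
    (CategoryTheory.projectiveDimension M).unbotD 0

variable (R : Type u) [Ring R]

/-- The finitistic dimension of `Rᵒᵖ`, in the convention where the modules over an algebra are
the finitely generated right modules: right modules over `Rᵒᵖ` are left modules over `R`. -/
def findimOp : ℕ∞ :=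
  findimOf fun M : ModuleCat.{u} R => Module.Finite R M

/-- The finitistic dimension of the class of finitely generated semisimple right modules over
`Rᵒᵖ`, that is, of semisimple left modules over `R`. If `R` is a finite dimensional algebra, this
class is the additive closure of the direct sum of the simple modules. -/
def findimOpSemisimple : ℕ∞ :=
  findimOf fun M : ModuleCat.{u} R => Module.Finite R M ∧ IsSemisimpleModule R M

end Findim

end

/-! Write L = A × B and let T be the ideal of C generated by the new arrows. Right modules over the
opposite algebra are left C-modules, so the two sides of T play different roles. An arrow of either
kind to the left of a new arrow gives zero, by a relation or because the two do not compose. Hence C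
→ L is a split surjection with kernel T, T² = 0, and T is semisimple as a left C-module
(`isSemisimpleModule_ker_retraction`). On the right, no relation involves a new arrow followed by an
old one: T is the direct sum of the right L-modules τL ≅ eL, where τ runs over the new arrows and e
is the idempotent at the target of τ. So C is flat as a right L-module (`isRightFlat_incl`).

Let M be finitely generated of finite projective dimension, N ⊆ Cⁿ a first syzygy and N' its image
in Lⁿ. Since Tⁿ is semisimple and C acts on it through L, the elements of N' can be lifted to N
semilinearly. This embeds the extension CN' into N, with a semisimple complement S
(`exists_equiv_extendSubmodule_prod`). Both summands inherit finite projective dimension. That of S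
is bounded by the semisimple term. For CN', flatness makes syzygies commute with extension, and the
retraction C → L descends projectivity, so CN' over C and N' over L have the same bounds
(`IsRightFlat.projDimLT_extendSubmodule`, `projDimLT_of_extendSubmodule`). Over the product L these
bounds come from A and B (`projDimLT_prod_of_findimOp_le`). The passage from M to N costs the
summand 1.

The semisimple term is finite because C is finite dimensional, so that all simple modules occur
among the composition factors of C (`findimOpSemisimple_lt_top`). -/

/-! ### Projective dimension, dimension shifting and semisimple modules -/

section ProjectiveDimension

open CategoryTheory

variable {R : Type u} [Ring R] {M N P : Type u} [AddCommGroup M] [Module R M]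
  [AddCommGroup N] [Module R N] [AddCommGroup P] [Module R P]

variable (R M) in
/-- The left `R`-module `M` has projective dimension less than `n`. -/
abbrev ProjDimLT (n : ℕ) : Prop :=
  HasProjectiveDimensionLT (ModuleCat.of R M) n

theorem ProjDimLT.mono {m n : ℕ} (h : ProjDimLT R M m) (hmn : m ≤ n) : ProjDimLT R M n :=
  hasProjectiveDimensionLT_of_ge _ m n hmn

theorem projDimLT_one_iff : ProjDimLT R M 1 ↔ Module.Projective R M := by
  rw [ProjDimLT, ← projective_iff_hasProjectiveDimensionLT_one, ← IsProjective.iff_projective]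

theorem ProjDimLT.of_retract {n : ℕ} (h : ProjDimLT R N n) (i : M →ₗ[R] N) (r : N →ₗ[R] M)
    (hri : ∀ x, r (i x) = x) : ProjDimLT R M n := by
  have e : Retract (ModuleCat.of R M) (ModuleCat.of R N) :=
    { i := ModuleCat.ofHom i
      r := ModuleCat.ofHom r
      retract := by ext x; exact hri x }
  exact e.hasProjectiveDimensionLT n

theorem ProjDimLT.of_equiv {n : ℕ} (h : ProjDimLT R N n) (e : M ≃ₗ[R] N) : ProjDimLT R M n :=
  h.of_retract e.toLinearMap e.symm.toLinearMap e.symm_apply_apply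

theorem ProjDimLT.of_subsingleton [Subsingleton M] (n : ℕ) : ProjDimLT R M n :=
  have h : HasProjectiveDimensionLT (ModuleCat.of R M) 0 :=
    (ModuleCat.isZero_of_subsingleton (ModuleCat.of R M)).hasProjectiveDimensionLT_zero
  ProjDimLT.mono h (Nat.zero_le n)

/-- Dimension shifting. The offset is needed: with `n + 1` and `n`, the case `n = 0` would say that
`M` is projective exactly when the kernel vanishes. -/
theorem projDimLT_ker_iff [Module.Projective R P] {f : P →ₗ[R] M} (hf : Function.Surjective f)
    (n : ℕ) : ProjDimLT R M (n + 2) ↔ ProjDimLT R (LinearMap.ker f) (n + 1) := by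
  have h := LinearMap.shortExact_shortComplexKer hf
  exact h.hasProjectiveDimensionLT_X₃_iff n
    ((IsProjective.iff_projective (R := R) P).1 inferInstance)

theorem ProjDimLT.prod {n : ℕ} (hM : ProjDimLT R M n) (hN : ProjDimLT R N n) :
    ProjDimLT R (M × N) n := by
  have hf : Function.Surjective (LinearMap.snd R M N) := LinearMap.snd_surjective
  refine (LinearMap.shortExact_shortComplexKer hf).hasProjectiveDimensionLT_X₂ n ?_ hN
  exact hM.of_retract (LinearMap.fst R M N ∘ₗ (LinearMap.ker (LinearMap.snd R M N)).subtype)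
    ((LinearMap.inl R M N).codRestrict _ fun x => by simp) fun ⟨⟨x, y⟩, h⟩ => by
      ext
      · rfl
      · exact (LinearMap.mem_ker.1 h).symm

theorem ProjDimLT.pi {n m : ℕ} {X : Fin m → Type u} [∀ i, AddCommGroup (X i)]
    [∀ i, Module R (X i)] (h : ∀ i, ProjDimLT R (X i) n) : ProjDimLT R (∀ i, X i) n := by
  induction m with
  | zero => exact .of_subsingleton n
  | succ m ih =>
    exact ((h 0).prod (ih fun i => h i.succ)).of_equiv (Fin.consLinearEquiv R X).symm

theorem projDimLT_of_findimOf_le {Q : ModuleCat.{u} R → Prop} {d n : ℕ}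
    (hd : findimOf Q ≤ d) (hM : Q (ModuleCat.of R M)) (h : ProjDimLT R M n) :
    ProjDimLT R M (d + 1) := by
  have htop : projectiveDimension (ModuleCat.of R M) ≠ ⊤ :=
    (projectiveDimension_ne_top_iff _).2 ⟨n, h.mono n.le_succ⟩
  have h1 : (projectiveDimension (ModuleCat.of R M)).unbotD 0 ≤ (d : ℕ∞) :=
    le_trans (le_iSup_of_le (ModuleCat.of R M) <| le_iSup_of_le hM <|
      le_iSup (fun _ => (projectiveDimension (ModuleCat.of R M)).unbotD 0) htop) hd
  refine (projectiveDimension_le_iff _ d).1 ?_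
  generalize projectiveDimension (ModuleCat.of R M) = e at h1
  induction e with
  | bot => exact bot_le
  | coe e => exact WithBot.coe_le_coe.2 h1

theorem findimOf_le {Q : ModuleCat.{u} R → Prop} {d : ℕ}
    (h : ∀ (M : Type u) [AddCommGroup M] [Module R M] (n : ℕ), Q (ModuleCat.of R M) →
      ProjDimLT R M n → ProjDimLT R M (d + 1)) : findimOf Q ≤ d := by
  refine iSup_le fun M => iSup_le fun hM => iSup_le fun htop => ?_
  obtain ⟨n, hn⟩ := (projectiveDimension_ne_top_iff M).1 htop
  have h1 := (projectiveDimension_le_iff M d).2 (h M (n + 1) hM hn)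
  generalize projectiveDimension M = e at h1
  induction e with
  | bot => exact bot_le
  | coe e => exact WithBot.coe_le_coe.1 h1

/-- Among the simple quotients of a module of finite length that have finite projective
dimension, the projective dimensions are bounded. -/
theorem IsFiniteLength.exists_projDimLT_bound (h : IsFiniteLength R M) :
    ∃ d : ℕ, ∀ (S : Type u) [AddCommGroup S] [Module R S] [IsSimpleModule R S]
      (f : M →ₗ[R] S) (n : ℕ), Function.Surjective f → ProjDimLT R S n → ProjDimLT R S d := by
  induction h with
  | of_subsingleton =>
    refine ⟨0, fun S _ _ _ f n hf _ => ?_⟩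
    have := hf.subsingleton
    exact .of_subsingleton 0
  | @of_simple_quotient M _ _ K hK _ ih =>
    obtain ⟨d, hd⟩ := ih
    classical
    -- The value 0 is never used: `m` matters only when `M ⧸ K` is isomorphic to a module of finite
    -- projective dimension.
    let m : ℕ := if h : ∃ n, ProjDimLT R (M ⧸ K) n then h.choose else 0
    refine ⟨max d m, fun S _ _ _ f n hf hS => ?_⟩
    -- Either `f` factors through the simple module `M ⧸ K`, which is then isomorphic to `S`, or its
    -- restriction to `K` is nonzero and hence still onto `S`.
    by_cases hfK : K ≤ LinearMap.ker f
    · let g := K.liftQ f hfK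
      have hg : Function.Surjective g := fun s => by
        obtain ⟨x, rfl⟩ := hf s
        exact ⟨K.mkQ x, rfl⟩
      have hg' : Function.Bijective g := by
        refine LinearMap.bijective_of_ne_zero fun h0 => ?_
        have := IsSimpleModule.nontrivial R S
        obtain ⟨s, hs⟩ := exists_ne (0 : S)
        obtain ⟨x, rfl⟩ := hg s
        exact hs (by rw [h0]; rfl)
      let e := LinearEquiv.ofBijective g hg'
      have hex : ∃ n, ProjDimLT R (M ⧸ K) n := ⟨n, hS.of_equiv e⟩
      have hm : ProjDimLT R (M ⧸ K) m := by
        simp only [m, dif_pos hex]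
        exact hex.choose_spec
      exact (hm.of_equiv e.symm).mono (le_max_right _ _)
    · refine (hd S (f ∘ₗ K.subtype) n (LinearMap.surjective_of_ne_zero fun h0 => hfK ?_) hS).mono
        (le_max_left _ _)
      intro x hx
      exact LinearMap.congr_fun h0 ⟨x, hx⟩

-- A finitely generated semisimple module is a finite direct sum of simple modules, each a summand
-- (so of finite projective dimension if the sum is) and each a quotient of `R`. Over an Artinian
-- ring, `R` has finite length, and the preceding bound applies to all of them at once.
variable (R) in
theorem findimOpSemisimple_lt_top [IsArtinianRing R] : findimOpSemisimple R < ⊤ := by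
  obtain ⟨d, hd⟩ := IsFiniteLength.exists_projDimLT_bound (R := R) (M := R)
    (isFiniteLength_iff_isNoetherian_isArtinian.2 ⟨inferInstance, inferInstance⟩)
  refine lt_of_le_of_lt (findimOf_le (d := d) ?_) (ENat.natCast_lt_top d)
  rintro M _ _ n ⟨hfin, hss⟩ hn
  have : Module.Finite R M := hfin
  have : IsSemisimpleModule R M := hss
  obtain ⟨m, S, e, hS⟩ := IsSemisimpleModule.exists_linearEquiv_fin_dfinsupp R M
  classical
  let e' : M ≃ₗ[R] ∀ i, S i := e.trans DFinsupp.linearEquivFunOnFintype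
  refine ((ProjDimLT.pi fun i => ?_).of_equiv e').mono d.le_succ
  have := hS i
  have := IsSimpleModule.nontrivial R (S i)
  obtain ⟨s, hs⟩ := exists_ne (0 : S i)
  refine hd (S i) (LinearMap.toSpanSingleton R _ s) n
    (IsSimpleModule.toSpanSingleton_surjective R hs) ?_
  exact hn.of_retract (e'.symm.toLinearMap ∘ₗ LinearMap.single R (fun i => S i) i)
    (LinearMap.proj i ∘ₗ e'.toLinearMap) fun x => by simp

end ProjectiveDimension

/-! ### Extension of submodules of free modules along a ring homomorphism -/

section BaseChange

variable {R S : Type u} [Ring R] [Ring S] (φ : R →+* S) {ι κ : Type u}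

/-- The entrywise application of a ring homomorphism to the vectors of a free module. -/
noncomputable def mapVec : (κ →₀ R) →+ (κ →₀ S) :=
  Finsupp.mapRange.addMonoidHom φ.toAddMonoidHom

@[simp]
theorem mapVec_apply (v : κ →₀ R) (i : κ) : mapVec φ v i = φ (v i) := rfl

@[simp]
theorem mapVec_smul (r : R) (v : κ →₀ R) : mapVec φ (r • v) = φ r • mapVec φ v := by
  ext i
  simp

@[simp]
theorem mapVec_single (i : κ) (r : R) :
    mapVec φ (Finsupp.single i r) = Finsupp.single i (φ r) :=
  Finsupp.mapRange_single (hf := map_zero φ)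

theorem linearCombination_mapVec (x : ι → κ →₀ R) (v : ι →₀ R) :
    Finsupp.linearCombination S (fun i => mapVec φ (x i)) (mapVec φ v) =
      mapVec φ (Finsupp.linearCombination R x v) := by
  induction v using Finsupp.induction_linear with
  | zero => simp
  | add v w hv hw => simp only [map_add, hv, hw]
  | single i r => simp

/-- The extension of a submodule of a free module along a ring homomorphism: the submodule
generated by its image. -/
noncomputable def extendSubmodule (N : Submodule R (κ →₀ R)) : Submodule S (κ →₀ S) :=
  Submodule.span S (mapVec φ '' N)

variable {φ} in
theorem mapVec_mem_extendSubmodule {N : Submodule R (κ →₀ R)} {v : κ →₀ R} (h : v ∈ N) :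
    mapVec φ v ∈ extendSubmodule φ N :=
  Submodule.subset_span ⟨v, h, rfl⟩

variable {φ} in
theorem extendSubmodule_le {N : Submodule R (κ →₀ R)} {N' : Submodule S (κ →₀ S)} :
    extendSubmodule φ N ≤ N' ↔ ∀ v ∈ N, mapVec φ v ∈ N' := by
  rw [extendSubmodule, Submodule.span_le, Set.image_subset_iff]
  rfl

theorem extendSubmodule_span (s : Set (κ →₀ R)) :
    extendSubmodule φ (Submodule.span R s) = Submodule.span S (mapVec φ '' s) := by
  refine le_antisymm (extendSubmodule_le.2 fun v hv => ?_)
    (Submodule.span_mono (Set.image_mono Submodule.subset_span))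
  induction hv using Submodule.span_induction with
  | mem v hv => exact Submodule.subset_span ⟨v, hv, rfl⟩
  | zero => simp
  | add v w _ _ hv hw => rw [map_add]; exact add_mem hv hw
  | smul r v _ hv => rw [mapVec_smul]; exact Submodule.smul_mem _ _ hv

theorem extendSubmodule_finite {N : Submodule R (κ →₀ R)} (h : N.FG) :
    (extendSubmodule φ N).FG := by
  obtain ⟨s, rfl⟩ := h
  rw [extendSubmodule_span]
  exact Submodule.fg_span (s.finite_toSet.image _)

theorem range_linearCombination_mapVec (x : ι → κ →₀ R) :
    LinearMap.range (Finsupp.linearCombination S fun i => mapVec φ (x i)) =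
      extendSubmodule φ (LinearMap.range (Finsupp.linearCombination R x)) := by
  rw [Finsupp.range_linearCombination, Finsupp.range_linearCombination, extendSubmodule_span,
    ← Set.range_comp]
  rfl

/-- Kernels of maps between free modules are generated over `S` by the kernels over `R`; that
is, `S` is flat as a right `R`-module. -/
def IsRightFlat : Prop :=
  ∀ (ι κ : Type u) (x : ι → κ →₀ R) (v : ι →₀ S),
    Finsupp.linearCombination S (fun i => mapVec φ (x i)) v = 0 →
      v ∈ extendSubmodule φ (LinearMap.ker (Finsupp.linearCombination R x))

variable {φ}

theorem IsRightFlat.ker_eq (h : IsRightFlat φ) (x : ι → κ →₀ R) :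
    LinearMap.ker (Finsupp.linearCombination S fun i => mapVec φ (x i)) =
      extendSubmodule φ (LinearMap.ker (Finsupp.linearCombination R x)) := by
  refine le_antisymm (fun v hv => h _ _ x v hv) (extendSubmodule_le.2 fun v hv => ?_)
  rw [LinearMap.mem_ker, linearCombination_mapVec, LinearMap.mem_ker.1 hv, map_zero]

theorem range_linearCombination_val {M : Type*} [AddCommGroup M] [Module R M]
    (N : Submodule R M) :
    LinearMap.range (Finsupp.linearCombination R (Subtype.val : N → M)) = N := by
  rw [Finsupp.range_linearCombination, Subtype.range_coe, Submodule.span_eq]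

/-- A splitting `s` of the free presentation `f` of `N` gives an endomorphism s ∘ f of the free
module on `N`. Its base change `E` satisfies F ∘ E = F and, by flatness, kills the kernel of `F`; so
it induces a section of `F` onto its range, the extension of `N`. -/
theorem IsRightFlat.projective_extendSubmodule (h : IsRightFlat φ) (N : Submodule R (κ →₀ R))
    [Module.Projective R N] : Module.Projective S (extendSubmodule φ N) := by
  set f := Finsupp.linearCombination R (Subtype.val : N → κ →₀ R) with hf
  set F := Finsupp.linearCombination S fun i : N => mapVec φ (i : κ →₀ R) with hF
  have hfr : LinearMap.range f = N := range_linearCombination_val N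
  have hFr : LinearMap.range F = extendSubmodule φ N := by
    rw [hF, range_linearCombination_mapVec, ← hf, hfr]
  obtain ⟨s, hs⟩ := Module.projective_lifting_property (f.codRestrict N fun v =>
    hfr.le ⟨v, rfl⟩) LinearMap.id (fun y => by
      obtain ⟨v, hv⟩ : (y : κ →₀ R) ∈ LinearMap.range f := by rw [hfr]; exact y.2
      exact ⟨v, Subtype.ext hv⟩)
  have hs' (y : N) : f (s y) = y := congrArg Subtype.val (LinearMap.congr_fun hs y)
  let E := Finsupp.linearCombination S fun i : N => mapVec φ (s i)
  -- Flatness enters here: the relations over `S` are generated by those over `R`, and s ∘ f kills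
  -- the latter.
  have hker : LinearMap.ker F ≤ LinearMap.ker E := by
    rw [hF, h.ker_eq, extendSubmodule_le]
    intro v hv
    have hv' : Finsupp.linearCombination R (fun i : N => s i) v = 0 := by
      have : Finsupp.linearCombination R (fun i : N => s i) =
          s ∘ₗ Finsupp.linearCombination R (id : N → N) :=
        Finsupp.lhom_ext' fun i => LinearMap.ext_ring (by simp)
      rw [this, LinearMap.comp_apply]
      have h0 : Finsupp.linearCombination R (id : N → N) v = 0 := by
        refine Subtype.ext ?_
        have := Finsupp.apply_linearCombination R N.subtype (id : N → N) v
        exact this.trans hv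
      rw [h0, map_zero]
    rw [LinearMap.mem_ker, linearCombination_mapVec, hv', map_zero]
  have hFE (v) : F (E v) = F v := by
    refine LinearMap.congr_fun (f := F ∘ₗ E) (g := F) ?_ v
    refine Finsupp.lhom_ext' fun i => LinearMap.ext_ring ?_
    simp only [LinearMap.comp_apply, Finsupp.lsingle_apply, E, hF,
      Finsupp.linearCombination_single, one_smul, linearCombination_mapVec]
    rw [← hf, hs']
  have hproj : Module.Projective S (LinearMap.range F) := by
    refine Module.Projective.of_split
      ((LinearMap.ker F).liftQ E hker ∘ₗ F.quotKerEquivRange.symm.toLinearMap)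
      F.rangeRestrict ?_
    ext ⟨_, v, rfl⟩ : 1
    refine Subtype.ext ?_
    have : F.quotKerEquivRange.symm ⟨F v, v, rfl⟩ = (LinearMap.ker F).mkQ v :=
      F.quotKerEquivRange_symm_apply_image v _
    simp only [LinearMap.comp_apply, LinearEquiv.coe_coe, this, LinearMap.id_apply]
    exact hFE v
  rwa [← hFr]

theorem projDimLT_range_iff {P M : Type u} [AddCommGroup P] [Module R P] [Module.Projective R P]
    [AddCommGroup M] [Module R M] (f : P →ₗ[R] M) (n : ℕ) :
    ProjDimLT R (LinearMap.range f) (n + 2) ↔ ProjDimLT R (LinearMap.ker f) (n + 1) := by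
  rw [projDimLT_ker_iff f.surjective_rangeRestrict, LinearMap.ker_rangeRestrict]

/-- For the presentation by all elements of `N`, the syzygy of the extension is the extension of the
syzygy. -/
theorem IsRightFlat.projDimLT_extendSubmodule_iff (h : IsRightFlat φ)
    (N : Submodule R (κ →₀ R)) (n : ℕ) :
    ProjDimLT S (extendSubmodule φ N) (n + 2) ↔ ProjDimLT S (extendSubmodule φ
      (LinearMap.ker (Finsupp.linearCombination R (Subtype.val : N → κ →₀ R)))) (n + 1) := by
  rw [← h.ker_eq, ← projDimLT_range_iff, range_linearCombination_mapVec,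
    range_linearCombination_val]

theorem IsRightFlat.projDimLT_extendSubmodule (h : IsRightFlat φ) {N : Submodule R (κ →₀ R)}
    {n : ℕ} (hN : ProjDimLT R N (n + 1)) : ProjDimLT S (extendSubmodule φ N) (n + 1) := by
  -- The syzygy lies in the free module on the set `N`, so the index type changes at each step.
  induction n generalizing κ with
  | zero =>
    have := projDimLT_one_iff.1 hN
    exact projDimLT_one_iff.2 (h.projective_extendSubmodule N)
  | succ n ih =>
    refine (h.projDimLT_extendSubmodule_iff N n).2 (ih ?_)
    rwa [← projDimLT_range_iff, range_linearCombination_val]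

/-- If projectivity of submodules of free modules is jointly detected by two flat ring
homomorphisms, then so are upper bounds of their projective dimension. -/
theorem projDimLT_of_extendSubmodule {S' : Type u} [Ring S'] {φ' : R →+* S'}
    (h : IsRightFlat φ) (h' : IsRightFlat φ')
    (hproj : ∀ {κ : Type u} (N : Submodule R (κ →₀ R)),
      Module.Projective S (extendSubmodule φ N) → Module.Projective S' (extendSubmodule φ' N) →
        Module.Projective R N)
    {N : Submodule R (κ →₀ R)} {n : ℕ} (hN : ProjDimLT S (extendSubmodule φ N) (n + 1))
    (hN' : ProjDimLT S' (extendSubmodule φ' N) (n + 1)) : ProjDimLT R N (n + 1) := by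
  induction n generalizing κ with
  | zero =>
    exact projDimLT_one_iff.2 (hproj N (projDimLT_one_iff.1 hN) (projDimLT_one_iff.1 hN'))
  | succ n ih =>
    have := ih ((h.projDimLT_extendSubmodule_iff N n).1 hN)
      ((h'.projDimLT_extendSubmodule_iff N n).1 hN')
    rwa [← projDimLT_range_iff, range_linearCombination_val] at this

/-- A projective extension of `N` provides lifts of the elements of `N` to the free module over
the set `N`. -/
theorem exists_section_extendSubmodule (N : Submodule R (κ →₀ R))
    [Module.Projective S (extendSubmodule φ N)] :
    ∃ s : N → (N →₀ S), (∀ x y, s (x + y) = s x + s y) ∧ (∀ (r : R) x, s (r • x) = φ r • s x) ∧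
      ∀ x, Finsupp.linearCombination S (fun i : N => mapVec φ (i : κ →₀ R)) (s x) =
        mapVec φ (x : κ →₀ R) := by
  set F := Finsupp.linearCombination S fun i : N => mapVec φ (i : κ →₀ R) with hF
  have hFr : LinearMap.range F = extendSubmodule φ N := by
    rw [hF, range_linearCombination_mapVec, range_linearCombination_val]
  obtain ⟨s, hs⟩ := Module.projective_lifting_property (F.codRestrict (extendSubmodule φ N)
    fun v => hFr.le ⟨v, rfl⟩) LinearMap.id (fun y => by
      obtain ⟨v, hv⟩ : (y : κ →₀ S) ∈ LinearMap.range F := by rw [hFr]; exact y.2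
      exact ⟨v, Subtype.ext hv⟩)
  refine ⟨fun x => s ⟨mapVec φ (x : κ →₀ R), mapVec_mem_extendSubmodule x.2⟩, fun x y => ?_,
    fun r x => ?_, fun x => congrArg Subtype.val (LinearMap.congr_fun hs _)⟩
  · exact (congrArg s (Subtype.ext (map_add (mapVec φ) (x : κ →₀ R) y))).trans (map_add s _ _)
  · exact (congrArg s (Subtype.ext (mapVec_smul φ r (x : κ →₀ R)))).trans (map_smul s (φ r) _)

theorem Module.Projective.of_section (N : Submodule R (κ →₀ R)) (s : N →ₗ[R] (N →₀ R))
    (hs : ∀ x, Finsupp.linearCombination R (Subtype.val : N → κ →₀ R) (s x) = x) :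
    Module.Projective R N :=
  Module.Projective.of_split s (Finsupp.linearCombination R (id : N → N)) <| by
    ext x : 1
    refine Subtype.ext ((Finsupp.apply_linearCombination R N.subtype (id : N → N) _).trans ?_)
    exact hs x

/-- Applying `π` entrywise to a section over `S` makes it `R`-linear, since `π` undoes `φ`. Flatness
is not needed. -/
theorem projective_of_extendSubmodule_of_retraction {π : S →+* R} (hπ : ∀ r, π (φ r) = r)
    (N : Submodule R (κ →₀ R)) [Module.Projective S (extendSubmodule φ N)] :
    Module.Projective R N := by
  obtain ⟨s, hadd, hsmul, hs⟩ := exists_section_extendSubmodule (φ := φ) N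
  have hmap (v : κ →₀ R) : mapVec π (mapVec φ v) = v := by
    ext i
    simp [hπ]
  refine Module.Projective.of_section N
    { toFun := fun x => mapVec π (s x)
      map_add' := fun x y => by rw [hadd, map_add]
      map_smul' := fun r x => by rw [hsmul, mapVec_smul, hπ, RingHom.id_apply] } fun x => ?_
  have h1 := linearCombination_mapVec π (fun i : N => mapVec φ (i : κ →₀ R)) (s x)
  simp only [hmap, hs] at h1
  exact h1

end BaseChange

/-! ### Modules over a product of two rings -/

section Prod

variable {A B : Type u} [Ring A] [Ring B] {κ : Type u}

theorem mapVec_fst_snd_ext {v w : κ →₀ A × B}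
    (h1 : mapVec (RingHom.fst A B) v = mapVec (RingHom.fst A B) w)
    (h2 : mapVec (RingHom.snd A B) v = mapVec (RingHom.snd A B) w) : v = w := by
  ext i
  · exact DFunLike.congr_fun h1 i
  · exact DFunLike.congr_fun h2 i

/-- The vector over a product ring with given components. -/
noncomputable def prodVec (v : κ →₀ A) (w : κ →₀ B) : κ →₀ A × B :=
  Finsupp.zipWith Prod.mk rfl v w

@[simp]
theorem mapVec_fst_prodVec (v : κ →₀ A) (w : κ →₀ B) :
    mapVec (RingHom.fst A B) (prodVec v w) = v := by
  ext i
  simp [prodVec]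

@[simp]
theorem mapVec_snd_prodVec (v : κ →₀ A) (w : κ →₀ B) :
    mapVec (RingHom.snd A B) (prodVec v w) = w := by
  ext i
  simp [prodVec]

variable (A B)

/-- A solution over `A`, padded by zero in the `B`-coordinate, is a solution over the product. -/
theorem isRightFlat_fst : IsRightFlat (RingHom.fst A B) := by
  intro ι κ x v hv
  rw [← mapVec_fst_prodVec v (0 : ι →₀ B)]
  refine mapVec_mem_extendSubmodule (mapVec_fst_snd_ext ?_ ?_)
  · rw [← linearCombination_mapVec, mapVec_fst_prodVec, hv, map_zero]
  · rw [← linearCombination_mapVec, mapVec_snd_prodVec, map_zero, map_zero]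

theorem isRightFlat_snd : IsRightFlat (RingHom.snd A B) := by
  intro ι κ x v hv
  rw [← mapVec_snd_prodVec (0 : ι →₀ A) v]
  refine mapVec_mem_extendSubmodule (mapVec_fst_snd_ext ?_ ?_)
  · rw [← linearCombination_mapVec, mapVec_fst_prodVec, map_zero, map_zero]
  · rw [← linearCombination_mapVec, mapVec_snd_prodVec, hv, map_zero]

variable {A B}

/-- The sections over the two factors combine coordinatewise to a section over the product. -/
theorem projective_of_extendSubmodule_fst_snd (N : Submodule (A × B) (κ →₀ A × B))
    (hA : Module.Projective A (extendSubmodule (RingHom.fst A B) N))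
    (hB : Module.Projective B (extendSubmodule (RingHom.snd A B) N)) :
    Module.Projective (A × B) N := by
  obtain ⟨s, hadd, hsmul, hs⟩ := exists_section_extendSubmodule (φ := RingHom.fst A B) N
  obtain ⟨t, tadd, tsmul, ht⟩ := exists_section_extendSubmodule (φ := RingHom.snd A B) N
  refine Module.Projective.of_section N
    { toFun := fun x => prodVec (s x) (t x)
      map_add' := fun x y => mapVec_fst_snd_ext (by simp [hadd]) (by simp [tadd])
      map_smul' := fun r x => mapVec_fst_snd_ext (by simp [hsmul]) (by simp [tsmul]) }
    fun x => mapVec_fst_snd_ext ?_ ?_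
  · refine (linearCombination_mapVec _ _ (prodVec (s x) (t x))).symm.trans ?_
    rw [mapVec_fst_prodVec, hs]
  · refine (linearCombination_mapVec _ _ (prodVec (s x) (t x))).symm.trans ?_
    rw [mapVec_snd_prodVec, ht]

/-- Over a product of two rings, the projective dimension of a finitely generated submodule of a
free module is bounded by the finitistic dimensions of the factors, if it is finite. -/
theorem projDimLT_prod_of_findimOp_le {d n : ℕ} (hA : findimOp A ≤ d) (hB : findimOp B ≤ d)
    {N : Submodule (A × B) (κ →₀ A × B)} (hfg : N.FG) (hN : ProjDimLT (A × B) N (n + 1)) :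
    ProjDimLT (A × B) N (d + 1) := by
  refine projDimLT_of_extendSubmodule (isRightFlat_fst A B) (isRightFlat_snd A B)
    projective_of_extendSubmodule_fst_snd ?_ ?_
  · exact projDimLT_of_findimOf_le hA (Module.Finite.iff_fg.2 (extendSubmodule_finite _ hfg))
      ((isRightFlat_fst A B).projDimLT_extendSubmodule hN)
  · exact projDimLT_of_findimOf_le hB (Module.Finite.iff_fg.2 (extendSubmodule_finite _ hfg))
      ((isRightFlat_snd A B).projDimLT_extendSubmodule hN)

end Prod

/-! ### Split extensions by a square-zero ideal -/

section Splitting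

theorem IsSemisimpleModule.exists_complement_in {R M : Type*} [Ring R] [AddCommGroup M]
    [Module R M] {T : Submodule R M} [IsSemisimpleModule R T] (U : Submodule R M) :
    ∃ W ≤ T, (∀ x ∈ T, ∃ y ∈ U, ∃ w ∈ W, y + w = x) ∧ ∀ x ∈ U, x ∈ W → x = 0 := by
  obtain ⟨W, hW⟩ := exists_isCompl (U.comap T.subtype)
  refine ⟨W.map T.subtype, Submodule.map_subtype_le T W, fun x hx => ?_, ?_⟩
  · have hmem : (⟨x, hx⟩ : T) ∈ U.comap T.subtype ⊔ W := by
      rw [hW.sup_eq_top]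
      trivial
    obtain ⟨y, hy, w, hw, h⟩ := Submodule.mem_sup.1 hmem
    exact ⟨y, hy, w, ⟨w, hw, rfl⟩, congrArg Subtype.val h⟩
  · rintro _ hx ⟨w, hw, rfl⟩
    have : w ∈ U.comap T.subtype ⊓ W := ⟨hx, hw⟩
    rw [hW.inf_eq_bot, Submodule.mem_bot] at this
    rw [this, map_zero]

theorem isSemisimpleModule_of_le {R M : Type*} [Ring R] [AddCommGroup M] [Module R M]
    {S T : Submodule R M} [IsSemisimpleModule R T] (h : S ≤ T) : IsSemisimpleModule R S :=
  IsSemisimpleModule.of_injective (M := T) (N := S) (Submodule.inclusion h)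
    (Submodule.inclusion_injective h)

/-- The single hypothesis `hf` contains both the injectivity of `f`, because 0 lies in `S`, and the
disjointness of its range from `S`. -/
theorem nonempty_equiv_prod {R M E : Type*} [Ring R] [AddCommGroup M] [Module R M]
    [AddCommGroup E] [Module R E] (f : E →ₗ[R] M) (S : Submodule R M)
    (hf : ∀ v, f v ∈ S → v = 0) :
    Nonempty ((LinearMap.range f ⊔ S : Submodule R M) ≃ₗ[R] E × S) := by
  have hinj : Function.Injective (f.coprod S.subtype) := by
    rw [← LinearMap.ker_eq_bot, LinearMap.ker_eq_bot']
    rintro ⟨v, s⟩ h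
    have h' : f v + (s : M) = 0 := h
    have hv : v = 0 := hf v (by rw [eq_neg_of_add_eq_zero_left h']; exact neg_mem s.2)
    rw [hv, map_zero, zero_add] at h'
    exact Prod.ext hv (Subtype.ext h')
  refine ⟨((LinearEquiv.ofInjective _ hinj).trans (LinearEquiv.ofEq _ _ ?_)).symm⟩
  rw [LinearMap.range_coprod, Submodule.range_subtype]

variable {C L : Type u} [Ring C] [Ring L] {κ : Type u}

theorem exists_mapVec_eq_of_mem_extendSubmodule {π : C →+* L} (hπ : Function.Surjective π)
    {N : Submodule C (κ →₀ C)} {x : κ →₀ L} (hx : x ∈ extendSubmodule π N) :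
    ∃ v ∈ N, mapVec π v = x := by
  induction hx using Submodule.span_induction with
  | mem x hx => exact hx
  | zero => exact ⟨0, zero_mem _, map_zero _⟩
  | add x y _ _ hx hy =>
    obtain ⟨v, hv, rfl⟩ := hx
    obtain ⟨w, hw, rfl⟩ := hy
    exact ⟨v + w, add_mem hv hw, map_add _ _ _⟩
  | smul r x _ hx =>
    obtain ⟨v, hv, rfl⟩ := hx
    obtain ⟨c, rfl⟩ := hπ r
    exact ⟨c • v, N.smul_mem c hv, mapVec_smul _ _ _⟩

/-- The vectors of a free module killed by a ring homomorphism. -/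
def kerVec (π : C →+* L) : Submodule C (κ →₀ C) where
  carrier := {v | mapVec π v = 0}
  zero_mem' := map_zero _
  add_mem' {v w} hv hw := by
    change mapVec π (v + w) = 0
    rw [map_add, show mapVec π v = 0 from hv, show mapVec π w = 0 from hw, add_zero]
  smul_mem' c v hv := by
    change mapVec π (c • v) = 0
    rw [mapVec_smul, show mapVec π v = 0 from hv, smul_zero]

theorem mem_kerVec {π : C →+* L} {v : κ →₀ C} : v ∈ kerVec π ↔ mapVec π v = 0 := Iff.rfl

/-- This module is a direct sum of copies of the kernel of `π`. -/
theorem isSemisimpleModule_kerVec (π : C →+* L) [IsSemisimpleModule C (RingHom.ker π)] :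
    IsSemisimpleModule C (kerVec π : Submodule C (κ →₀ C)) := by
  have h : LinearMap.range (Finsupp.mapRange.linearMap (α := κ)
      (Submodule.subtype (RingHom.ker π))) = kerVec π := by
    ext v
    constructor
    · rintro ⟨w, rfl⟩
      rw [mem_kerVec]
      ext i
      exact (w i).2
    · intro hv
      classical
      refine ⟨Finsupp.onFinset v.support (fun i => ⟨v i, DFunLike.congr_fun hv i⟩) fun i hi => ?_,
        ?_⟩
      · rw [Finsupp.mem_support_iff]
        exact fun h0 => hi (Subtype.ext h0)
      · ext i
        rfl
  rw [← h]
  exact .range _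

/-- Let `π : C → L` be a split surjection of rings whose kernel has square zero and is semisimple
as a left module. Then every submodule of a free `C`-module is the direct sum of a semisimple
module and of the extension of its image over `L`. -/
theorem exists_equiv_extendSubmodule_prod {φ : L →+* C} {π : C →+* L} (hπφ : ∀ r, π (φ r) = r)
    (hsq : ∀ s t, π s = 0 → π t = 0 → s * t = 0) [IsSemisimpleModule C (RingHom.ker π)]
    (N : Submodule C (κ →₀ C)) :
    ∃ S : Submodule C (κ →₀ C), IsSemisimpleModule C S ∧
      Nonempty (N ≃ₗ[C] extendSubmodule φ (extendSubmodule π N) × S) := by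
  have hsurj : Function.Surjective π := fun r => ⟨φ r, hπφ r⟩
  have hmap (x : κ →₀ L) : mapVec π (mapVec φ x) = x := by
    ext i
    simp [hπφ]
  -- Since the kernel has square zero, `C` acts on it through `L`. This later turns the semilinear
  -- `g` into a `C`-linear map.
  have hact (c : C) {t : κ →₀ C} (ht : t ∈ kerVec π) : c • t = φ (π c) • t := by
    ext i
    have h := hsq (c - φ (π c)) (t i) (by rw [map_sub, hπφ, sub_self]) (DFunLike.congr_fun ht i)
    rw [sub_mul, sub_eq_zero] at h
    exact h
  have hss : IsSemisimpleModule C (kerVec π : Submodule C (κ →₀ C)) :=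
    isSemisimpleModule_kerVec π
  -- Two lifts to `N` of an element of the image differ by an element of N ∩ ker. Corrections taken
  -- from the complement `W` of this intersection in the kernel are therefore unique, and uniqueness
  -- forces `g` to be additive and semilinear.
  obtain ⟨W, hWT, hW1, hW2⟩ :=
    IsSemisimpleModule.exists_complement_in (T := kerVec π) (N ⊓ kerVec π)
  set N' := extendSubmodule π N with hN'
  have hex (x : N') : ∃ w ∈ W, mapVec φ (x : κ →₀ L) + w ∈ N := by
    obtain ⟨v, hv, hvx⟩ := exists_mapVec_eq_of_mem_extendSubmodule hsurj x.2
    obtain ⟨y, hy, w, hw, h⟩ := hW1 (v - mapVec φ (x : κ →₀ L)) (by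
      rw [mem_kerVec, map_sub, hmap, hvx, sub_self])
    refine ⟨w, hw, ?_⟩
    rw [show mapVec φ (x : κ →₀ L) + w = v - y by rw [eq_sub_of_add_eq' h]; abel]
    exact sub_mem hv hy.1
  choose g hgW hgN using hex
  have huniq (x : N') (w : κ →₀ C) (hw : w ∈ W) (h : mapVec φ (x : κ →₀ L) + w ∈ N) :
      g x = w := by
    refine sub_eq_zero.1 (hW2 _ ⟨?_, hWT (sub_mem (hgW x) hw)⟩ (sub_mem (hgW x) hw))
    have := sub_mem (hgN x) h
    rwa [add_sub_add_left_eq_sub] at this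
  have hgadd (x y : N') : g (x + y) = g x + g y := by
    refine huniq _ _ (add_mem (hgW x) (hgW y)) ?_
    rw [Submodule.coe_add, map_add, add_add_add_comm]
    exact add_mem (hgN x) (hgN y)
  have hgsmul (r : L) (x : N') : g (r • x) = φ r • g x := by
    refine huniq _ _ (W.smul_mem _ (hgW x)) ?_
    rw [Submodule.coe_smul, mapVec_smul, ← smul_add]
    exact N.smul_mem _ (hgN x)
  have hπE (v : extendSubmodule φ N') : mapVec π (v : κ →₀ C) ∈ N' := by
    obtain ⟨v, hv⟩ := v
    induction hv using Submodule.span_induction with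
    | mem v hv =>
      obtain ⟨x, hx, rfl⟩ := hv
      exact (hmap x).symm ▸ hx
    | zero => simp
    | add v w _ _ hv hw => rw [map_add]; exact add_mem hv hw
    | smul c v _ hv => rw [mapVec_smul]; exact N'.smul_mem _ hv
  let p : extendSubmodule φ N' → N' := fun v => ⟨mapVec π (v : κ →₀ C), hπE v⟩
  -- The extension of `N'` need not lie in `N`; adding the correction `g` moves it into `N` without
  -- changing the image under `π`.
  let f : extendSubmodule φ N' →ₗ[C] (κ →₀ C) :=
    { toFun := fun v => v + g (p v)
      map_add' := fun v w => by
        have : p (v + w) = p v + p w := Subtype.ext (map_add (mapVec π) (v : κ →₀ C) w)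
        rw [this, hgadd, Submodule.coe_add, add_add_add_comm]
      map_smul' := fun c v => by
        have : p (c • v) = π c • p v := Subtype.ext (mapVec_smul π c (v : κ →₀ C))
        rw [this, hgsmul, Submodule.coe_smul, RingHom.id_apply, smul_add,
          hact c (hWT (hgW (p v)))] }
  have hf (v) : f v = v + g (p v) := rfl
  have hπf (v) : mapVec π (f v) = mapVec π (v : κ →₀ C) := by
    rw [hf, map_add, mem_kerVec.1 (hWT (hgW (p v))), add_zero]
  have hfx (x : N') : f ⟨_, mapVec_mem_extendSubmodule x.2⟩ = mapVec φ (x : κ →₀ L) + g x := by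
    rw [hf]
    congr 2
    exact Subtype.ext (hmap x)
  have hfN : LinearMap.range f ≤ N := by
    rintro _ ⟨⟨v, hv⟩, rfl⟩
    induction hv using Submodule.span_induction with
    | mem v hv =>
      obtain ⟨x, hx, rfl⟩ := hv
      exact (hfx ⟨x, hx⟩).symm ▸ hgN ⟨x, hx⟩
    | zero => exact (map_zero f).symm ▸ zero_mem N
    | add v w hv' hw' hv hw =>
      have := map_add f ⟨v, hv'⟩ ⟨w, hw'⟩
      exact this.symm ▸ add_mem hv hw
    | smul c v hv' hv =>
      have := map_smul f c ⟨v, hv'⟩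
      exact this.symm ▸ N.smul_mem c hv
  have hfinj : ∀ v, f v ∈ (⊥ : Submodule C (κ →₀ C)) → v = 0 := by
    intro v hv
    rw [Submodule.mem_bot] at hv
    have h0 : p v = 0 := Subtype.ext (by
      change mapVec π (v : κ →₀ C) = 0
      rw [← hπf, hv, map_zero])
    have hg0 : g 0 = 0 := huniq 0 0 (zero_mem _) (by simp)
    rw [hf, h0, hg0, add_zero] at hv
    exact Subtype.ext hv
  -- Modulo the range of `f`, every element of `N` lies in the kernel. So a complement in the kernel
  -- of its part inside the range, cut down to `N`, complements the range of `f` in `N`.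
  obtain ⟨S, hST, hS1, hS2⟩ := IsSemisimpleModule.exists_complement_in
    (T := kerVec π) (LinearMap.range f ⊓ (N ⊓ kerVec π))
  refine ⟨S ⊓ N, isSemisimpleModule_of_le (inf_le_left.trans hST), ?_⟩
  have hsup : LinearMap.range f ⊔ S ⊓ N = N := by
    refine le_antisymm (sup_le hfN inf_le_right) fun v hv => ?_
    let x : N' := ⟨mapVec π v, mapVec_mem_extendSubmodule hv⟩
    have hy : v - f ⟨_, mapVec_mem_extendSubmodule x.2⟩ ∈
        (kerVec π : Submodule C (κ →₀ C)) := by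
      rw [mem_kerVec, map_sub, hπf, hmap, sub_self]
    obtain ⟨y, ⟨hyf, hyN, -⟩, s, hs, h⟩ := hS1 _ hy
    have hsN : s ∈ N := by
      rw [eq_sub_of_add_eq' h]
      exact sub_mem (sub_mem hv (hfN ⟨_, rfl⟩)) hyN
    rw [eq_add_of_sub_eq' h.symm, ← add_assoc]
    exact Submodule.add_mem_sup (add_mem ⟨_, rfl⟩ hyf) ⟨hs, hsN⟩
  have hdisj (v) (hv : f v ∈ S ⊓ N) : v = 0 :=
    hfinj v ((Submodule.mem_bot C).2 (hS2 _ ⟨⟨v, rfl⟩, hv.2, hST hv.1⟩ hv.1))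
  have := nonempty_equiv_prod (E := extendSubmodule φ N') (M := κ →₀ C) f (S ⊓ N) hdisj
  rwa [hsup] at this

/-- The bound for the finitistic dimension of a split extension of `A × B` by an ideal of square
zero that is semisimple on the left and flat on the right. -/
theorem findimOp_le_of_splitting {A B C : Type u} [Ring A] [Ring B] [Ring C] [IsNoetherianRing C]
    {φ : A × B →+* C} {π : C →+* A × B} (hπφ : ∀ r, π (φ r) = r)
    (hsq : ∀ s t, π s = 0 → π t = 0 → s * t = 0) [IsSemisimpleModule C (RingHom.ker π)]
    (hflat : IsRightFlat φ) {d : ℕ} (hA : findimOp A ≤ d) (hB : findimOp B ≤ d)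
    (hC : findimOpSemisimple C ≤ d) : findimOp C ≤ (d + 1 : ℕ) := by
  refine findimOf_le fun M _ _ n hfin hM => ?_
  obtain ⟨s, hs⟩ := Module.Finite.fg_top (R := C) (M := M) (self := hfin)
  let f := Finsupp.linearCombination C (Subtype.val : s → M)
  have hf : Function.Surjective f := by
    rw [← LinearMap.range_eq_top, Finsupp.range_linearCombination, Subtype.range_coe]
    exact hs
  -- Passing to the first syzygy puts the problem inside a free module; this is the source of the `+
  -- 1` in the bound.
  have hker := (projDimLT_ker_iff hf n).1 (hM.mono (by lia))
  have hfg : (LinearMap.ker f).FG := IsNoetherian.noetherian _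
  obtain ⟨S, hS, ⟨e⟩⟩ := exists_equiv_extendSubmodule_prod hπφ hsq (LinearMap.ker f)
  have hE : ProjDimLT C (extendSubmodule φ (extendSubmodule π (LinearMap.ker f))) (n + 1) :=
    hker.of_retract (e.symm.toLinearMap ∘ₗ LinearMap.inl C _ _)
      (LinearMap.fst C _ _ ∘ₗ e.toLinearMap) fun x => by simp
  have hSn : ProjDimLT C S (n + 1) :=
    hker.of_retract (e.symm.toLinearMap ∘ₗ LinearMap.inr C _ _)
      (LinearMap.snd C _ _ ∘ₗ e.toLinearMap) fun x => by simp
  have hSfin : Module.Finite C S := by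
    have := Module.Finite.iff_fg.2 hfg
    let g : LinearMap.ker f →ₗ[C] S :=
      { toFun := fun x => (e x).2
        map_add' := fun x y => by rw [map_add]; rfl
        map_smul' := fun c x => by rw [map_smul]; rfl }
    exact Module.Finite.of_surjective g (Prod.snd_surjective.comp e.surjective)
  -- One homomorphism already detects projectivity here, because of the retraction; it fills both
  -- slots of the criterion.
  have hL := projDimLT_of_extendSubmodule hflat hflat
    (fun N h _ => projective_of_extendSubmodule_of_retraction hπφ N) hE hE
  have hE' := hflat.projDimLT_extendSubmodule
    (projDimLT_prod_of_findimOp_le hA hB (extendSubmodule_finite π hfg) hL)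
  have hS' : ProjDimLT C S (d + 1) := projDimLT_of_findimOf_le hC ⟨hSfin, hS⟩ hSn
  exact (projDimLT_ker_iff hf d).2 ((hE'.prod hS').of_equiv e)

/-- A ring extension is right flat if it is the sum of `L` and of a direct sum of right ideals
generated by idempotents. -/
theorem isRightFlat_of_generators {φ : L →+* C} {π : C →+* L} (hπφ : ∀ r, π (φ r) = r)
    {I : Type*} [Fintype I] (τ : I → C) (ε : I → L) (hτ : ∀ i, π (τ i) = 0)
    (hτε : ∀ i, τ i * φ (ε i) = τ i)
    (hspan : ∀ t, π t = 0 → ∃ l : I → L, t = ∑ i, τ i * φ (l i))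
    (hindep : ∀ l : I → L, ∑ i, τ i * φ (l i) = 0 → ∀ i, ε i * l i = 0) : IsRightFlat φ := by
  intro ι κ x v hv
  classical
  have hπmap (w : κ →₀ L) : mapVec π (mapVec φ w) = w := by
    ext i
    simp [hπφ]
  have hex (c : C) : ∃ l : I → L, c - φ (π c) = ∑ i, τ i * φ (l i) :=
    hspan _ (by rw [map_sub, hπφ, sub_self])
  choose l hl using hex
  -- The coefficients chosen for the element 0 may be nonzero, so they are replaced by 0 to keep the
  -- support finite.
  let w (i : I) : ι →₀ L := Finsupp.onFinset v.support
    (fun j => if v j = 0 then 0 else l (v j) i) fun j hj => by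
      rw [Finsupp.mem_support_iff]
      exact fun h0 => hj (if_pos h0)
  have hv_eq : v = mapVec φ (mapVec π v) + ∑ i, τ i • mapVec φ (w i) := by
    ext j
    simp only [Finsupp.add_apply, mapVec_apply, Finsupp.finsetSum_apply, Finsupp.smul_apply, w,
      Finsupp.onFinset_apply, smul_eq_mul]
    by_cases h0 : v j = 0
    · simp [h0]
    · simp only [if_neg h0]
      rw [← hl, add_sub_cancel]
  set f := Finsupp.linearCombination L x with hf
  rw [hv_eq] at hv
  simp only [map_add, map_sum, map_smul, linearCombination_mapVec, ← hf] at hv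
  have hv0 : f (mapVec π v) = 0 := by
    have := congrArg (mapVec π) hv
    simpa only [map_add, map_sum, mapVec_smul, hτ, zero_smul, Finset.sum_const_zero, add_zero,
      hπmap, map_zero] using this
  rw [hv0, map_zero, zero_add] at hv
  -- The vector `w i` itself need not be a relation. Only its multiple by `ε i` is, and this
  -- suffices because τ i absorbs `φ (ε i)` on the right.
  have hw0 (i : I) : f (ε i • w i) = 0 := by
    rw [map_smul]
    ext k
    refine hindep (fun i => f (w i) k) ?_ i
    have := DFunLike.congr_fun hv k
    simpa only [Finsupp.finsetSum_apply, Finsupp.smul_apply, mapVec_apply, smul_eq_mul,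
      Finsupp.zero_apply] using this
  rw [hv_eq]
  refine add_mem (mapVec_mem_extendSubmodule hv0) (sum_mem fun i _ => ?_)
  rw [← hτε i, mul_smul, ← mapVec_smul]
  exact Submodule.smul_mem _ _ (mapVec_mem_extendSubmodule (hw0 i))

end Splitting

/-- Each nonzero generator spans over `C` only a line over `k`, hence a simple module; the span is
the sum of these. -/
theorem isSemisimpleModule_span_of_smul_mem_line (k : Type*) {C M : Type*} [Field k] [Ring C]
    [Algebra k C] [AddCommGroup M] [Module k M] [Module C M] [IsScalarTower k C M] {Y : Set M}
    (hY : ∀ y ∈ Y, ∀ c : C, ∃ r : k, c • y = r • y) :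
    IsSemisimpleModule C (Submodule.span C Y) := by
  rw [Submodule.span_eq_iSup_of_singleton_spans]
  refine isSemisimpleModule_biSup_of_isSemisimpleModule_submodule fun y hy => ?_
  by_cases h0 : y = 0
  · have : Subsingleton (Submodule.span C {y}) := by
      rw [h0, Submodule.span_zero_singleton]
      infer_instance
    exact { exists_isCompl := fun U => ⟨U, disjoint_of_subsingleton, codisjoint_of_subsingleton⟩ }
  have hyS := Submodule.mem_span_singleton_self (R := C) y
  have hsimple : IsSimpleModule C (Submodule.span C {y}) := by
    refine isSimpleModule_iff_toSpanSingleton_surjective.2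
      ⟨⟨⟨y, hyS⟩, 0, fun h => h0 (congrArg Subtype.val h)⟩, ?_⟩
    rintro ⟨x, hx⟩ hx0 ⟨z, hz⟩
    obtain ⟨c, rfl⟩ := Submodule.mem_span_singleton.1 hx
    obtain ⟨d, rfl⟩ := Submodule.mem_span_singleton.1 hz
    obtain ⟨r, hr⟩ := hY y hy c
    have hr0 : r ≠ 0 := by
      rintro rfl
      exact hx0 (Subtype.ext (hr.trans (zero_smul k y)))
    refine ⟨d * algebraMap k C r⁻¹, Subtype.ext ?_⟩
    change (d * algebraMap k C r⁻¹) • c • y = d • y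
    rw [hr, mul_smul, algebraMap_smul, inv_smul_smul₀ hr0]
  infer_instance

/-! ### The universal property of the path algebra -/

namespace PathAlgebra

theorem ofPath_cons {k V : Type u} [Field k] [Quiver.{u} V] {a b c : V} (p : Quiver.Path a b)
    (f : b ⟶ c) : (ofPath (p.cons f) : PathAlgebra k V) = ofPath p * ofArrow f :=
  (ofPath_mul_ofPath p f.toPath).symm

variable {k V R : Type u} [Field k] [Quiver.{u} V] [Fintype V] [Ring R] [Algebra k R]

variable (V R) in
/-- Images of the vertices and of the arrows of a quiver in a ring, satisfying the relations of
the path algebra. -/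
structure Values where
  vertex : V → R
  arrow : ∀ {a b : V}, (a ⟶ b) → R
  vertex_mul_self : ∀ a, vertex a * vertex a = vertex a
  vertex_mul_of_ne : ∀ a b, a ≠ b → vertex a * vertex b = 0
  sum_vertex : ∑ a, vertex a = 1
  vertex_mul_arrow : ∀ {a b : V} (f : a ⟶ b), vertex a * arrow f = arrow f
  arrow_mul_vertex : ∀ {a b : V} (f : a ⟶ b), arrow f * vertex b = arrow f

namespace Values

variable (v : Values V R)

/-- The value of a path. -/
def path {a : V} : ∀ {b : V}, Quiver.Path a b → R
  | _, .nil => v.vertex a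
  | _, .cons p f => path p * v.arrow f

theorem vertex_mul_path {a b : V} (p : Quiver.Path a b) : v.vertex a * v.path p = v.path p := by
  induction p with
  | nil => exact v.vertex_mul_self a
  | cons p f ih => rw [path, ← mul_assoc, ih]

theorem path_mul_vertex {a b : V} (p : Quiver.Path a b) : v.path p * v.vertex b = v.path p := by
  cases p with
  | nil => exact v.vertex_mul_self a
  | cons p f => rw [path, mul_assoc, v.arrow_mul_vertex]

theorem path_comp {a b c : V} (p : Quiver.Path a b) (q : Quiver.Path b c) :
    v.path (p.comp q) = v.path p * v.path q := by
  induction q with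
  | nil => exact (v.path_mul_vertex p).symm
  | cons q f ih => rw [Quiver.Path.comp_cons, path, path, ih, mul_assoc]

theorem path_mul_path_of_ne {a b c d : V} (p : Quiver.Path a b) (q : Quiver.Path c d)
    (h : c ≠ b) : v.path p * v.path q = 0 := by
  rw [← v.path_mul_vertex p, ← v.vertex_mul_path q, mul_assoc, ← mul_assoc (v.vertex b),
    v.vertex_mul_of_ne b c h.symm, zero_mul, mul_zero]

variable (k) in
/-- The linear extension of the values of the paths. -/
noncomputable def liftLinear : PathAlgebra k V →ₗ[k] R :=
  Finsupp.linearCombination k fun p : QuiverPath V => v.path p.2.2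

@[simp]
theorem liftLinear_ofPath {a b : V} (p : Quiver.Path a b) :
    v.liftLinear k (ofPath p) = v.path p := by
  refine (Finsupp.linearCombination_single (R := k) 1 (⟨a, b, p⟩ : QuiverPath V)).trans ?_
  exact one_smul k _

theorem liftLinear_one : v.liftLinear k 1 = 1 := by
  rw [one_def, map_sum, ← v.sum_vertex]
  exact Finset.sum_congr rfl fun a _ => v.liftLinear_ofPath .nil

theorem liftLinear_mul (x y : PathAlgebra k V) :
    v.liftLinear k (x * y) = v.liftLinear k x * v.liftLinear k y := by
  induction x using induction_linear with
  | h0 => simp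
  | hadd x x' hx hx' => simp only [add_mul, map_add, hx, hx']
  | hpath r a b p =>
    induction y using induction_linear with
    | h0 => simp
    | hadd y y' hy hy' => simp only [mul_add, map_add, hy, hy']
    | hpath s c d q =>
      simp only [smul_mul_assoc, mul_smul_comm, map_smul, liftLinear_ofPath]
      congr 2
      by_cases h : c = b
      · subst h
        rw [ofPath_mul_ofPath, liftLinear_ofPath, path_comp]
      · rw [ofPath_mul_ofPath_of_ne p q h, map_zero, v.path_mul_path_of_ne p q h]

variable (k) in
/-- The homomorphism of algebras from the path algebra with given values. -/
noncomputable def lift : PathAlgebra k V →ₐ[k] R :=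
  AlgHom.ofLinearMap (v.liftLinear k) v.liftLinear_one v.liftLinear_mul

@[simp]
theorem lift_ofPath {a b : V} (p : Quiver.Path a b) : v.lift k (ofPath p) = v.path p :=
  v.liftLinear_ofPath p

end Values

theorem linearMap_ext {M : Type*} [AddCommGroup M] [Module k M] {f g : PathAlgebra k V →ₗ[k] M}
    (h : ∀ (a b : V) (p : Quiver.Path a b), f (ofPath p) = g (ofPath p)) : f = g := by
  ext x
  induction x using induction_linear with
  | h0 => simp
  | hadd x y hx hy => simp only [map_add, hx, hy]
  | hpath r a b p => rw [map_smul, map_smul, h]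

variable (V) in
theorem finite_setOf_length_eq [∀ a b : V, Finite (a ⟶ b)] (n : ℕ) :
    {p : QuiverPath V | p.2.2.length = n}.Finite := by
  induction n with
  | zero =>
    refine (Set.finite_range fun a : V => (⟨a, a, .nil⟩ : QuiverPath V)).subset ?_
    rintro ⟨a, b, p⟩ hp
    cases p with
    | nil => exact ⟨a, rfl⟩
    | cons p f => exact absurd hp (Nat.succ_ne_zero _)
  | succ n ih =>
    have := ih.to_subtype
    refine (Set.finite_range fun q : Σ (p : {p : QuiverPath V | p.2.2.length = n}) (c : V),
      (p.1.2.1 ⟶ c) => (⟨q.1.1.1, q.2.1, q.1.1.2.2.cons q.2.2⟩ : QuiverPath V)).subset ?_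
    rintro ⟨a, b, p⟩ hp
    cases p with
    | nil => exact absurd hp (Nat.succ_ne_zero n).symm
    | @cons c _ p f => exact ⟨⟨⟨⟨a, c, p⟩, Nat.succ_injective hp⟩, b, f⟩, rfl⟩

end PathAlgebra

/-! ### Bound quiver algebras: universal property, finite dimension, characters -/

namespace BoundQuiverAlgebra

open PathAlgebra

variable {k V R : Type u} [Field k] [Quiver.{u} V] [Fintype V] [Ring R] [Algebra k R]
  (I : TwoSidedIdeal (PathAlgebra k V))

/-- The projection from the path algebra to its quotient. -/
noncomputable def proj : PathAlgebra k V →ₐ[k] BoundQuiverAlgebra I where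
  __ := I.ringCon.mk'
  commutes' _ := rfl

theorem proj_surjective : Function.Surjective (proj I) :=
  I.ringCon.mk'_surjective

variable {I}

theorem proj_eq_zero_iff {x : PathAlgebra k V} : proj I x = 0 ↔ x ∈ I := by
  rw [TwoSidedIdeal.mem_iff]
  exact I.ringCon.eq (a := x) (b := 0)

theorem linearMap_ext {M : Type*} [AddCommGroup M] [Module k M]
    {f g : BoundQuiverAlgebra I →ₗ[k] M}
    (h : ∀ (a b : V) (p : Quiver.Path a b), f (proj I (ofPath p)) = g (proj I (ofPath p))) :
    f = g := by
  ext x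
  obtain ⟨x, rfl⟩ := proj_surjective I x
  exact LinearMap.congr_fun (PathAlgebra.linearMap_ext (f := f ∘ₗ (proj I).toLinearMap)
    (g := g ∘ₗ (proj I).toLinearMap) h) x

/-- Linear maps that vanish on the ideal descend to the quotient. -/
noncomputable def liftLinear {M : Type*} [AddCommGroup M] [Module k M] (f : PathAlgebra k V →ₗ[k] M)
    (h : ∀ x ∈ I, f x = 0) : BoundQuiverAlgebra I →ₗ[k] M where
  __ := I.ringCon.toAddCon.lift f.toAddMonoidHom fun x y hxy => by
    have := h _ ((I.rel_iff x y).1 hxy)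
    rw [map_sub, sub_eq_zero] at this
    exact this
  map_smul' r x := by
    obtain ⟨x, rfl⟩ := proj_surjective I x
    exact map_smul f r x

/-- Homomorphisms of algebras that vanish on the ideal descend to the quotient. -/
noncomputable def lift (f : PathAlgebra k V →ₐ[k] R) (h : ∀ x ∈ I, f x = 0) : BoundQuiverAlgebra I →ₐ[k] R :=
  AlgHom.ofLinearMap (liftLinear f.toLinearMap h) (map_one f) fun x y => by
    obtain ⟨x, rfl⟩ := proj_surjective I x
    obtain ⟨y, rfl⟩ := proj_surjective I y
    exact map_mul f x y

/-- Paths of length at least `m` vanish in the quotient, and only finitely many shorter ones exist.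
-/
theorem finite_of_isAdmissible [∀ a b : V, Finite (a ⟶ b)] (hI : IsAdmissible I) :
    Module.Finite k (BoundQuiverAlgebra I) := by
  obtain ⟨-, m, -, hm⟩ := hI
  have hfin : {p : QuiverPath V | p.2.2.length < m}.Finite :=
    ((Set.finite_lt_nat m).biUnion fun n _ => finite_setOf_length_eq V n).subset
      fun p hp => Set.mem_biUnion (x := p.2.2.length) hp rfl
  refine ⟨Submodule.fg_def.2 ⟨_, hfin.image fun p => proj I (ofPath p.2.2), ?_⟩⟩
  rw [eq_top_iff]
  rintro x -
  obtain ⟨x, rfl⟩ := proj_surjective I x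
  induction x using induction_linear with
  | h0 => simp
  | hadd x y hx hy => rw [map_add]; exact add_mem hx hy
  | hpath r a b p =>
    rw [map_smul]
    refine Submodule.smul_mem _ _ ?_
    by_cases hp : p.length < m
    · exact Submodule.subset_span ⟨⟨a, b, p⟩, hp, rfl⟩
    · rw [proj_eq_zero_iff.2 (hm _ (Submodule.subset_span ⟨a, b, p, not_lt.1 hp, rfl⟩))]
      exact zero_mem _

open Classical in
/-- The values of the character of the path algebra at a vertex. -/
noncomputable def charValues (k : Type u) [Field k] (a : V) : Values V k where
  vertex b := if b = a then 1 else 0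
  arrow _ := 0
  vertex_mul_self b := by simp
  vertex_mul_of_ne b c h := by
    by_cases hb : b = a
    · subst hb
      rw [if_neg h.symm, mul_zero]
    · rw [if_neg hb, zero_mul]
  sum_vertex := by simp
  vertex_mul_arrow _ := mul_zero _
  arrow_mul_vertex _ := zero_mul _

/-- The character of a bound quiver algebra at a vertex. -/
noncomputable def character (hI : IsAdmissible I) (a : V) : BoundQuiverAlgebra I →ₐ[k] k :=
  lift ((charValues k a).lift k) fun x hx => by
    -- The character kills every path of positive length, so the inclusion of `I` in J² is more than
    -- enough.
    have h : arrowIdealPow k V 2 ≤ LinearMap.ker ((charValues k a).lift k).toLinearMap := by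
      refine Submodule.span_le.2 ?_
      rintro _ ⟨b, c, p, hp, rfl⟩
      refine ((charValues k a).lift_ofPath p).trans ?_
      cases p with
      | nil => exact absurd hp (by simp)
      | cons p f => exact mul_zero _
    exact h (hI.1 x hx)

theorem character_nil_self (hI : IsAdmissible I) (a : V) :
    character hI a (proj I (ofPath (Quiver.Path.nil : Quiver.Path a a))) = 1 :=
  ((charValues k a).lift_ofPath _).trans (if_pos rfl)

theorem character_ofArrow (hI : IsAdmissible I) (a : V) {b c : V} (f : b ⟶ c) :
    character hI a (proj I (ofArrow f)) = 0 :=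
  ((charValues k a).lift_ofPath _).trans (mul_zero _)

end BoundQuiverAlgebra

/-! ### Multiplicativity of the maps induced by morphisms of quivers -/

namespace PathAlgebra

section

variable {k V W : Type u} [Field k] [Quiver.{u} V] [Quiver.{u} W]

/-- Injectivity on vertices keeps the images of non-composable paths non-composable. -/
theorem mapQuiver_mul (φ : V ⥤q W) (hφ : Function.Injective φ.obj) (x y : PathAlgebra k V)
    [Fintype V] [Fintype W] :
    mapQuiver φ (x * y) = mapQuiver φ x * mapQuiver φ y := by
  induction x using induction_linear with
  | h0 => simp
  | hadd x x' hx hx' => simp only [add_mul, map_add, hx, hx']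
  | hpath r a b p =>
    induction y using induction_linear with
    | h0 => simp
    | hadd y y' hy hy' => simp only [mul_add, map_add, hy, hy']
    | hpath s c d q =>
      simp only [smul_mul_assoc, mul_smul_comm, map_smul, mapQuiver_ofPath]
      congr 2
      by_cases h : c = b
      · subst h
        rw [ofPath_mul_ofPath, ofPath_mul_ofPath, mapQuiver_ofPath, Prefunctor.mapPath_comp]
      · rw [ofPath_mul_ofPath_of_ne p q h, map_zero,
          ofPath_mul_ofPath_of_ne _ _ fun e => h (hφ e)]

theorem mapQuiver_mul_mapQuiver_of_ne {V' : Type u} [Quiver.{u} V'] [Fintype W] (φ : V ⥤q W)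
    (ψ : V' ⥤q W) (h : ∀ a b, ψ.obj b ≠ φ.obj a) (x : PathAlgebra k V) (y : PathAlgebra k V') :
    mapQuiver φ x * mapQuiver ψ y = 0 := by
  induction x using induction_linear with
  | h0 => simp
  | hadd x x' hx hx' => simp only [add_mul, map_add, hx, hx', add_zero]
  | hpath r a b p =>
    induction y using induction_linear with
    | h0 => simp
    | hadd y y' hy hy' => simp only [mul_add, map_add, hy, hy', add_zero]
    | hpath s c d q =>
      simp only [smul_mul_assoc, mul_smul_comm, map_smul, mapQuiver_ofPath]
      rw [ofPath_mul_ofPath_of_ne _ _ (h _ _), smul_zero, smul_zero]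

end

@[simp]
theorem Values.lift_ofArrow {k V R : Type u} [Field k] [Quiver.{u} V] [Fintype V] [Ring R]
    [Algebra k R] (v : Values V R) {a b : V} (f : a ⟶ b) : v.lift k (ofArrow f) = v.arrow f :=
  (v.lift_ofPath _).trans (v.vertex_mul_arrow f)

end PathAlgebra

/-! ### The glued algebra: inclusion of A × B, new arrows, universal property -/

namespace Glue

open PathAlgebra BoundQuiverAlgebra

theorem sum_univ {V W : Type u} {J : V → W → Type u} {K : W → V → Type u} [Fintype V]
    [Fintype W] {M : Type*} [AddCommMonoid M] (f : Glue J K → M) :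
    ∑ x, f x = ∑ a, f (inl a) + ∑ b, f (inr b) := by
  refine Eq.trans ?_ (Fintype.sum_sum_type fun x : V ⊕ W => f (equivSum.symm x))
  exact Fintype.sum_equiv equivSum _ _ fun x => by rw [Equiv.symm_apply_apply]

variable {k V W : Type u} [Field k] [Quiver.{u} V] [Quiver.{u} W]
  {J : V → W → Type u} {K : W → V → Type u}

theorem inclLeft_obj_injective : Function.Injective (inclLeft J K).obj := fun _ _ h =>
  inl.inj h

theorem inclRight_obj_injective : Function.Injective (inclRight J K).obj := fun _ _ h =>
  inr.inj h

variable [Fintype V] [Fintype W]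
  (IA : TwoSidedIdeal (PathAlgebra k V)) (IB : TwoSidedIdeal (PathAlgebra k W))

theorem proj_mem_ideal {x : PathAlgebra k (Glue J K)} (h : IsRelation J K IA IB x) :
    proj (ideal J K IA IB) x = 0 :=
  proj_eq_zero_iff.2 (TwoSidedIdeal.subset_span h)

variable (J K) in
/-- The linear map from the algebra of the first quiver to the glued algebra. -/
noncomputable def leftMap : BoundQuiverAlgebra IA →ₗ[k] BoundQuiverAlgebra (ideal J K IA IB) :=
  liftLinear ((proj (ideal J K IA IB)).toLinearMap ∘ₗ mapQuiver (inclLeft J K)) fun x hx =>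
    proj_mem_ideal IA IB (.ofLeft x hx)

variable (J K) in
/-- The linear map from the algebra of the second quiver to the glued algebra. -/
noncomputable def rightMap : BoundQuiverAlgebra IB →ₗ[k] BoundQuiverAlgebra (ideal J K IA IB) :=
  liftLinear ((proj (ideal J K IA IB)).toLinearMap ∘ₗ mapQuiver (inclRight J K)) fun x hx =>
    proj_mem_ideal IA IB (.ofRight x hx)

theorem leftMap_proj (x : PathAlgebra k V) : leftMap J K IA IB (proj IA x) =
    proj (ideal J K IA IB) (mapQuiver (inclLeft J K) x) := rfl

theorem rightMap_proj (x : PathAlgebra k W) : rightMap J K IA IB (proj IB x) =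
    proj (ideal J K IA IB) (mapQuiver (inclRight J K) x) := rfl

/-- Neither map preserves the unit; the trivial paths of the glued quiver are those of both quivers
together. -/
theorem leftMap_one_add_rightMap_one :
    leftMap J K IA IB 1 + rightMap J K IA IB 1 = 1 := by
  rw [← map_one (proj IA), ← map_one (proj IB), leftMap_proj, rightMap_proj, ← map_add, one_def,
    one_def, map_sum, map_sum, ← map_one (proj (ideal J K IA IB)), one_def, sum_univ]
  simp only [mapQuiver_ofPath]
  rfl

variable (J K) in
/-- The inclusion of the product of the algebras of the two quivers into the glued algebra. -/
noncomputable def incl : BoundQuiverAlgebra IA × BoundQuiverAlgebra IB →ₐ[k]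
    BoundQuiverAlgebra (ideal J K IA IB) :=
  AlgHom.ofLinearMap ((leftMap J K IA IB).coprod (rightMap J K IA IB))
    (leftMap_one_add_rightMap_one IA IB) fun x y => by
      obtain ⟨x, x'⟩ := x
      obtain ⟨y, y'⟩ := y
      obtain ⟨x, rfl⟩ := proj_surjective IA x
      obtain ⟨y, rfl⟩ := proj_surjective IA y
      obtain ⟨x', rfl⟩ := proj_surjective IB x'
      obtain ⟨y', rfl⟩ := proj_surjective IB y'
      simp only [LinearMap.coprod_apply, Prod.mk_mul_mk, ← map_mul, leftMap_proj, rightMap_proj,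
        mapQuiver_mul _ inclLeft_obj_injective, mapQuiver_mul _ inclRight_obj_injective]
      simp only [← map_add, ← map_mul, add_mul, mul_add]
      rw [mapQuiver_mul_mapQuiver_of_ne (inclLeft J K) (inclRight J K) (fun _ _ h => by cases h),
        mapQuiver_mul_mapQuiver_of_ne (inclRight J K) (inclLeft J K) (fun _ _ h => by cases h),
        add_zero, zero_add]

theorem incl_apply (x : BoundQuiverAlgebra IA × BoundQuiverAlgebra IB) :
    incl J K IA IB x = leftMap J K IA IB x.1 + rightMap J K IA IB x.2 := rfl

theorem incl_left (x : PathAlgebra k V) : incl J K IA IB (proj IA x, 0) =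
    proj (ideal J K IA IB) (mapQuiver (inclLeft J K) x) := by
  rw [incl_apply, map_zero, add_zero, leftMap_proj]

theorem incl_right (x : PathAlgebra k W) : incl J K IA IB (0, proj IB x) =
    proj (ideal J K IA IB) (mapQuiver (inclRight J K) x) := by
  rw [incl_apply, map_zero, zero_add, rightMap_proj]

variable (J K) in
/-- The arrows between the two quivers. -/
abbrev NewArrow : Type u :=
  (Σ (a : V) (b : W), J a b) ⊕ (Σ (b : W) (a : V), K b a)

/-- The start of a new arrow. -/
def NewArrow.src : NewArrow J K → Glue J K
  | .inl j => inl j.1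
  | .inr l => inr l.1

/-- The target of a new arrow. -/
def NewArrow.tgt : NewArrow J K → Glue J K
  | .inl j => inr j.2.1
  | .inr l => inl l.2.1

/-- A new arrow as an element of the glued algebra. -/
noncomputable def NewArrow.elem : NewArrow J K → BoundQuiverAlgebra (ideal J K IA IB)
  | .inl j => proj _ (arrow k (Arrow.alpha j.2.2))
  | .inr l => proj _ (arrow k (Arrow.beta l.2.2))

/-- The idempotent of a vertex of the glued quiver in the product of the two algebras. -/
noncomputable def vertexProd : Glue J K → BoundQuiverAlgebra IA × BoundQuiverAlgebra IB
  | inl a => (proj IA (ofPath (Quiver.Path.nil : Quiver.Path a a)), 0)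
  | inr b => (0, proj IB (ofPath (Quiver.Path.nil : Quiver.Path b b)))

theorem vertexProd_mul_self (x : Glue J K) :
    vertexProd IA IB x * vertexProd IA IB x = vertexProd IA IB x := by
  cases x <;>
  simp only [vertexProd, Prod.mk_mul_mk, ← map_mul, mul_zero, ofPath_mul_ofPath,
    Quiver.Path.comp_nil]

theorem vertexProd_mul_of_ne (x y : Glue J K) (h : x ≠ y) :
    vertexProd IA IB x * vertexProd IA IB y = 0 := by
  cases x <;> cases y <;>
  simp only [vertexProd, Prod.mk_mul_mk, ← map_mul, mul_zero, zero_mul, Prod.mk_zero_zero]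
  · rw [ofPath_mul_ofPath_of_ne _ _ fun e => h (congrArg inl e.symm), map_zero, Prod.mk_zero_zero]
  · rw [ofPath_mul_ofPath_of_ne _ _ fun e => h (congrArg inr e.symm), map_zero, Prod.mk_zero_zero]

theorem sum_vertexProd : ∑ x : Glue J K, vertexProd IA IB x = 1 := by
  rw [sum_univ]
  simp only [vertexProd]
  refine Prod.ext ?_ ?_
  · simp only [Prod.fst_add, Prod.fst_sum, Finset.sum_const_zero, add_zero, ← map_sum,
      Prod.fst_one]
    exact map_one (proj IA)
  · simp only [Prod.snd_add, Prod.snd_sum, Finset.sum_const_zero, zero_add, ← map_sum,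
      Prod.snd_one]
    exact map_one (proj IB)

theorem incl_vertexProd (x : Glue J K) : incl J K IA IB (vertexProd IA IB x) =
    proj (ideal J K IA IB) (ofPath (Quiver.Path.nil : Quiver.Path x x)) := by
  cases x
  · rw [vertexProd, incl_left, mapQuiver_ofPath]; rfl
  · rw [vertexProd, incl_right, mapQuiver_ofPath]; rfl

theorem incl_arrow_left {a a' : V} (f : a ⟶ a') : incl J K IA IB (proj IA (ofArrow f), 0) =
    proj (ideal J K IA IB) (arrow k (Arrow.left f)) := by
  rw [incl_left, ofArrow, mapQuiver_ofPath]; rfl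

theorem incl_arrow_right {b b' : W} (g : b ⟶ b') : incl J K IA IB (0, proj IB (ofArrow g)) =
    proj (ideal J K IA IB) (arrow k (Arrow.right g)) := by
  rw [incl_right, ofArrow, mapQuiver_ofPath]; rfl

theorem vertex_mul_arrow {x y : Glue J K} (f : Arrow x y) :
    incl J K IA IB (vertexProd IA IB x) * proj _ (arrow k f) = proj _ (arrow k f) := by
  rw [incl_vertexProd, ← map_mul, arrow, ofArrow, ofPath_mul_ofPath, Quiver.Path.nil_comp]

theorem arrow_mul_vertex {x y : Glue J K} (f : Arrow x y) :
    proj _ (arrow k f) * incl J K IA IB (vertexProd IA IB y) = proj _ (arrow k f) := by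
  rw [incl_vertexProd, ← map_mul, arrow, ofArrow, ofPath_mul_ofPath, Quiver.Path.comp_nil]

theorem proj_arrow_mul_of_ne {x y z w : Glue J K} (f : Arrow x y) (g : Arrow z w) (h : z ≠ y) :
    proj (ideal J K IA IB) (arrow k f) * proj _ (arrow k g) = 0 := by
  rw [← map_mul, arrow, arrow, ofArrow, ofArrow, ofPath_mul_ofPath_of_ne _ _ h, map_zero]

theorem vertex_mul_elem (i : NewArrow J K) :
    incl J K IA IB (vertexProd IA IB i.src) * i.elem IA IB = i.elem IA IB := by
  cases i <;> exact vertex_mul_arrow IA IB _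

theorem elem_mul_vertex (i : NewArrow J K) :
    i.elem IA IB * incl J K IA IB (vertexProd IA IB i.tgt) = i.elem IA IB := by
  cases i <;> exact arrow_mul_vertex IA IB _

theorem left_mul_elem {a a' : V} (f : a ⟶ a') (i : NewArrow J K) :
    incl J K IA IB (proj IA (ofArrow f), 0) * i.elem IA IB = 0 := by
  rw [incl_arrow_left]
  cases i with
  | inl j => exact (map_mul _ _ _).symm.trans (proj_mem_ideal IA IB (.left_alpha f j.2.2))
  | inr l => exact proj_arrow_mul_of_ne IA IB _ _ fun h => by cases h

theorem right_mul_elem {b b' : W} (g : b ⟶ b') (i : NewArrow J K) :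
    incl J K IA IB (0, proj IB (ofArrow g)) * i.elem IA IB = 0 := by
  rw [incl_arrow_right]
  cases i with
  | inl j => exact proj_arrow_mul_of_ne IA IB _ _ fun h => by cases h
  | inr l => exact (map_mul _ _ _).symm.trans (proj_mem_ideal IA IB (.right_beta g l.2.2))

/-- Two new arrows of the same direction never compose; in opposite directions the product is a
defining relation. -/
theorem elem_mul_elem (i j : NewArrow J K) : i.elem IA IB * j.elem IA IB = 0 := by
  cases i <;> cases j
  · exact proj_arrow_mul_of_ne IA IB _ _ fun h => by cases h
  · exact (map_mul _ _ _).symm.trans (proj_mem_ideal IA IB (.alpha_beta _ _))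
  · exact (map_mul _ _ _).symm.trans (proj_mem_ideal IA IB (.beta_alpha _ _))
  · exact proj_arrow_mul_of_ne IA IB _ _ fun h => by cases h

variable (J K) in
/-- Images of the two algebras and of the new arrows in an algebra, satisfying the relations of
the glued algebra. -/
structure GlueValues (R : Type u) [Ring R] [Algebra k R] where
  hom : BoundQuiverAlgebra IA × BoundQuiverAlgebra IB →ₐ[k] R
  elem : NewArrow J K → R
  vertex_mul_elem : ∀ i, hom (vertexProd IA IB i.src) * elem i = elem i
  elem_mul_vertex : ∀ i, elem i * hom (vertexProd IA IB i.tgt) = elem i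
  left_mul_elem : ∀ {a a' : V} (f : a ⟶ a') i, hom (proj IA (ofArrow f), 0) * elem i = 0
  right_mul_elem : ∀ {b b' : W} (g : b ⟶ b') i, hom (0, proj IB (ofArrow g)) * elem i = 0
  elem_mul_elem : ∀ i j, elem i * elem j = 0

namespace GlueValues

variable {IA IB} {R : Type u} [Ring R] [Algebra k R] (v : GlueValues J K IA IB R)

/-- The value of an arrow of the glued quiver. -/
noncomputable def arrow : ∀ {x y : Glue J K}, Arrow x y → R
  | _, _, .left f => v.hom (proj IA (ofArrow f), 0)
  | _, _, .right g => v.hom (0, proj IB (ofArrow g))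
  | _, _, .alpha j => v.elem (.inl ⟨_, _, j⟩)
  | _, _, .beta l => v.elem (.inr ⟨_, _, l⟩)

theorem hom_vertex_mul_arrow {x y : Glue J K} (f : Arrow x y) :
    v.hom (vertexProd IA IB x) * v.arrow f = v.arrow f := by
  cases f with
  | left f =>
    rw [arrow, ← map_mul, vertexProd, Prod.mk_mul_mk, ← map_mul, mul_zero, ofArrow,
      ofPath_mul_ofPath, Quiver.Path.nil_comp]
  | right g =>
    rw [arrow, ← map_mul, vertexProd, Prod.mk_mul_mk, ← map_mul, mul_zero, ofArrow,
      ofPath_mul_ofPath, Quiver.Path.nil_comp]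
  | alpha j => exact v.vertex_mul_elem (.inl ⟨_, _, j⟩)
  | beta l => exact v.vertex_mul_elem (.inr ⟨_, _, l⟩)

theorem arrow_mul_hom_vertex {x y : Glue J K} (f : Arrow x y) :
    v.arrow f * v.hom (vertexProd IA IB y) = v.arrow f := by
  cases f with
  | left f =>
    rw [arrow, ← map_mul, vertexProd, Prod.mk_mul_mk, ← map_mul, mul_zero, ofArrow,
      ofPath_mul_ofPath, Quiver.Path.comp_nil]
  | right g =>
    rw [arrow, ← map_mul, vertexProd, Prod.mk_mul_mk, ← map_mul, mul_zero, ofArrow,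
      ofPath_mul_ofPath, Quiver.Path.comp_nil]
  | alpha j => exact v.elem_mul_vertex (.inl ⟨_, _, j⟩)
  | beta l => exact v.elem_mul_vertex (.inr ⟨_, _, l⟩)

/-- The values of the vertices and arrows of the glued quiver. -/
noncomputable def values : Values (Glue J K) R where
  vertex x := v.hom (vertexProd IA IB x)
  arrow f := v.arrow f
  vertex_mul_self x := by rw [← map_mul, vertexProd_mul_self]
  vertex_mul_of_ne x y h := by rw [← map_mul, vertexProd_mul_of_ne IA IB x y h, map_zero]
  sum_vertex := by rw [← map_sum, sum_vertexProd, map_one]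
  vertex_mul_arrow f := v.hom_vertex_mul_arrow f
  arrow_mul_vertex f := v.arrow_mul_hom_vertex f

theorem path_mapPath_inclLeft {a b : V} (p : Quiver.Path a b) :
    v.values.path ((inclLeft J K).mapPath p) = v.hom (proj IA (ofPath p), 0) := by
  induction p with
  | nil => rfl
  | cons p f ih =>
    have h : v.values.path ((inclLeft J K).mapPath (p.cons f)) =
      v.values.path ((inclLeft J K).mapPath p) * v.hom (proj IA (ofArrow f), 0) := rfl
    rw [h, ih, ← map_mul, Prod.mk_mul_mk, mul_zero, ← map_mul, ofPath_cons]

theorem path_mapPath_inclRight {a b : W} (p : Quiver.Path a b) :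
    v.values.path ((inclRight J K).mapPath p) = v.hom (0, proj IB (ofPath p)) := by
  induction p with
  | nil => rfl
  | cons p f ih =>
    have h : v.values.path ((inclRight J K).mapPath (p.cons f)) =
      v.values.path ((inclRight J K).mapPath p) * v.hom (0, proj IB (ofArrow f)) := rfl
    rw [h, ih, ← map_mul, Prod.mk_mul_mk, mul_zero, ← map_mul, ofPath_cons]

theorem lift_mapQuiver_inclLeft (x : PathAlgebra k V) :
    v.values.lift k (mapQuiver (inclLeft J K) x) = v.hom (proj IA x, 0) := by
  refine LinearMap.congr_fun (f := (v.values.lift k).toLinearMap ∘ₗ mapQuiver (inclLeft J K))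
    (g := v.hom.toLinearMap ∘ₗ LinearMap.inl k _ _ ∘ₗ (proj IA).toLinearMap)
    (PathAlgebra.linearMap_ext fun a b p => ?_) x
  change v.values.lift k (mapQuiver (inclLeft J K) (ofPath p)) = v.hom (proj IA (ofPath p), 0)
  rw [mapQuiver_ofPath, Values.lift_ofPath, path_mapPath_inclLeft]

theorem lift_mapQuiver_inclRight (x : PathAlgebra k W) :
    v.values.lift k (mapQuiver (inclRight J K) x) = v.hom (0, proj IB x) := by
  refine LinearMap.congr_fun (f := (v.values.lift k).toLinearMap ∘ₗ mapQuiver (inclRight J K))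
    (g := v.hom.toLinearMap ∘ₗ LinearMap.inr k _ _ ∘ₗ (proj IB).toLinearMap)
    (PathAlgebra.linearMap_ext fun a b p => ?_) x
  change v.values.lift k (mapQuiver (inclRight J K) (ofPath p)) = v.hom (0, proj IB (ofPath p))
  rw [mapQuiver_ofPath, Values.lift_ofPath, path_mapPath_inclRight]

theorem lift_arrow {x y : Glue J K} (f : Arrow x y) :
    v.values.lift k (Glue.arrow k f) = v.arrow f :=
  v.values.lift_ofArrow _

/-- The homomorphism from the glued algebra with given values. -/
noncomputable def lift : BoundQuiverAlgebra (ideal J K IA IB) →ₐ[k] R :=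
  BoundQuiverAlgebra.lift (v.values.lift k) fun x hx => by
    have h : ideal J K IA IB ≤ TwoSidedIdeal.ker (v.values.lift k) := by
      refine TwoSidedIdeal.span_le.2 fun x hx => (TwoSidedIdeal.mem_ker _).2 ?_
      cases hx with
      | ofLeft x hx =>
        rw [lift_mapQuiver_inclLeft, proj_eq_zero_iff.2 hx]
        exact map_zero v.hom
      | ofRight x hx =>
        rw [lift_mapQuiver_inclRight, proj_eq_zero_iff.2 hx]
        exact map_zero v.hom
      | left_alpha f j =>
        rw [map_mul, lift_arrow, lift_arrow]
        exact v.left_mul_elem f _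
      | right_beta g l =>
        rw [map_mul, lift_arrow, lift_arrow]
        exact v.right_mul_elem g _
      | alpha_beta j l =>
        rw [map_mul, lift_arrow, lift_arrow]
        exact v.elem_mul_elem _ _
      | beta_alpha l j =>
        rw [map_mul, lift_arrow, lift_arrow]
        exact v.elem_mul_elem _ _
    exact (TwoSidedIdeal.mem_ker _).1 (h hx)

theorem lift_elem (i : NewArrow J K) : v.lift (i.elem IA IB) = v.elem i := by
  cases i <;> exact v.lift_arrow _

theorem lift_incl (x : BoundQuiverAlgebra IA × BoundQuiverAlgebra IB) :
    v.lift (incl J K IA IB x) = v.hom x := by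
  obtain ⟨x, y⟩ := x
  obtain ⟨x, rfl⟩ := proj_surjective IA x
  obtain ⟨y, rfl⟩ := proj_surjective IB y
  have h : ((proj IA x, proj IB y) : BoundQuiverAlgebra IA × BoundQuiverAlgebra IB) =
      (proj IA x, 0) + (0, proj IB y) := by simp
  rw [h, map_add, map_add, map_add, incl_left, incl_right]
  exact congrArg₂ _ (v.lift_mapQuiver_inclLeft x) (v.lift_mapQuiver_inclRight y)

end GlueValues

end Glue

/-! ### The kernel of C → A × B as a left and as a right module -/

namespace Glue

open PathAlgebra BoundQuiverAlgebra

variable {k V W : Type u} [Field k] [Quiver.{u} V] [Quiver.{u} W] [Fintype V] [Fintype W]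
  {J : V → W → Type u} {K : W → V → Type u}
  {IA : TwoSidedIdeal (PathAlgebra k V)} {IB : TwoSidedIdeal (PathAlgebra k W)}

/-- The character of the product of the two algebras at a vertex of the glued quiver. -/
noncomputable def char (hIA : IsAdmissible IA) (hIB : IsAdmissible IB) :
    Glue J K → (BoundQuiverAlgebra IA × BoundQuiverAlgebra IB →ₐ[k] k)
  | inl a => (character hIA a).comp (AlgHom.fst k _ _)
  | inr b => (character hIB b).comp (AlgHom.snd k _ _)

section

variable (hIA : IsAdmissible IA) (hIB : IsAdmissible IB)

theorem char_vertexProd_self (x : Glue J K) : char hIA hIB x (vertexProd IA IB x) = 1 := by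
  cases x
  · exact character_nil_self hIA _
  · exact character_nil_self hIB _

theorem char_vertexProd_of_ne {x y : Glue J K} (h : x ≠ y) :
    char hIA hIB x (vertexProd IA IB y) = 0 := by
  have := congrArg (char hIA hIB x) (vertexProd_mul_of_ne IA IB x y h)
  rwa [map_mul, char_vertexProd_self, one_mul, map_zero] at this

theorem char_arrow_left (x : Glue J K) {a a' : V} (f : a ⟶ a') :
    char hIA hIB x (proj IA (ofArrow f), 0) = 0 := by
  cases x with
  | inl a => exact character_ofArrow hIA a f
  | inr b => exact map_zero (character hIB b)

theorem char_arrow_right (x : Glue J K) {b b' : W} (g : b ⟶ b') :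
    char hIA hIB x (0, proj IB (ofArrow g)) = 0 := by
  cases x with
  | inl a => exact map_zero (character hIA a)
  | inr b => exact character_ofArrow hIB b g

theorem incl_vertexProd_mul_elem (x : Glue J K) (i : NewArrow J K) :
    incl J K IA IB (vertexProd IA IB x) * i.elem IA IB =
      char hIA hIB i.src (vertexProd IA IB x) • i.elem IA IB := by
  by_cases h : i.src = x
  · rw [← h, char_vertexProd_self, one_smul, vertex_mul_elem]
  · rw [char_vertexProd_of_ne hIA hIB h, zero_smul, ← vertex_mul_elem, ← mul_assoc, ← map_mul,
      vertexProd_mul_of_ne IA IB _ _ (Ne.symm h), map_zero, zero_mul]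

/-- Both sides are linear in `x`, so paths suffice. A trivial path acts by 1 or 0 according to the
source of `i`; the last arrow of a longer path meets `i` and gives zero, as does the character. Left
semisimplicity and the square-zero property both rest on this. -/
theorem incl_mul_elem (x : BoundQuiverAlgebra IA × BoundQuiverAlgebra IB) (i : NewArrow J K) :
    incl J K IA IB x * i.elem IA IB = char hIA hIB i.src x • i.elem IA IB := by
  refine LinearMap.congr_fun
    (f := LinearMap.mulRight k (i.elem IA IB) ∘ₗ (incl J K IA IB).toLinearMap)
    (g := (char hIA hIB i.src).toLinearMap.smulRight (i.elem IA IB))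
    (LinearMap.prod_ext (BoundQuiverAlgebra.linearMap_ext fun a b p => ?_)
      (BoundQuiverAlgebra.linearMap_ext fun a b p => ?_)) x
  · change incl J K IA IB (proj IA (ofPath p), 0) * i.elem IA IB =
      char hIA hIB i.src (proj IA (ofPath p), 0) • i.elem IA IB
    cases p with
    | nil => exact incl_vertexProd_mul_elem hIA hIB (inl a) i
    | cons p f =>
      have h : ((proj IA (ofPath (p.cons f)), 0) : BoundQuiverAlgebra IA × BoundQuiverAlgebra IB) =
          (proj IA (ofPath p), 0) * (proj IA (ofArrow f), 0) := by
        rw [Prod.mk_mul_mk, mul_zero, ← map_mul, ofPath_cons]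
      rw [h, map_mul, map_mul, char_arrow_left, mul_assoc, left_mul_elem, mul_zero, mul_zero,
        zero_smul]
  · change incl J K IA IB (0, proj IB (ofPath p)) * i.elem IA IB =
      char hIA hIB i.src (0, proj IB (ofPath p)) • i.elem IA IB
    cases p with
    | nil => exact incl_vertexProd_mul_elem hIA hIB (inr a) i
    | cons p f =>
      have h : ((0, proj IB (ofPath (p.cons f))) : BoundQuiverAlgebra IA × BoundQuiverAlgebra IB) =
          (0, proj IB (ofPath p)) * (0, proj IB (ofArrow f)) := by
        rw [Prod.mk_mul_mk, mul_zero, ← map_mul, ofPath_cons]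
      rw [h, map_mul, map_mul, char_arrow_right, mul_assoc, right_mul_elem, mul_zero, mul_zero,
        zero_smul]

end

theorem elem_mul_incl_mul_elem (hIA : IsAdmissible IA) (hIB : IsAdmissible IB)
    (i j : NewArrow J K) (x : BoundQuiverAlgebra IA × BoundQuiverAlgebra IB) :
    i.elem IA IB * incl J K IA IB x * j.elem IA IB = 0 := by
  rw [mul_assoc, incl_mul_elem hIA hIB, mul_smul_comm, elem_mul_elem, smul_zero]

variable (J K IA IB) in
/-- The values that define the projection of the glued algebra onto the product of the two
algebras. -/
noncomputable def retractionValues : GlueValues J K IA IB (BoundQuiverAlgebra IA × BoundQuiverAlgebra IB) where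
  hom := AlgHom.id k _
  elem _ := 0
  vertex_mul_elem _ := mul_zero _
  elem_mul_vertex _ := zero_mul _
  left_mul_elem _ _ := mul_zero _
  right_mul_elem _ _ := mul_zero _
  elem_mul_elem _ _ := mul_zero _

variable (J K IA IB) in
/-- The projection of the glued algebra onto the product of the two algebras. -/
noncomputable def retraction :
    BoundQuiverAlgebra (ideal J K IA IB) →ₐ[k] BoundQuiverAlgebra IA × BoundQuiverAlgebra IB :=
  (retractionValues J K IA IB).lift

theorem retraction_incl (x : BoundQuiverAlgebra IA × BoundQuiverAlgebra IB) :
    retraction J K IA IB (incl J K IA IB x) = x :=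
  (retractionValues J K IA IB).lift_incl x

theorem retraction_elem (i : NewArrow J K) : retraction J K IA IB (i.elem IA IB) = 0 :=
  (retractionValues J K IA IB).lift_elem i

/-- The diagonal embedding of an augmented algebra into the upper triangular matrices. -/
noncomputable def diagHom {L : Type u} [Ring L] [Algebra k L] (χ : L →ₐ[k] k) :
    L →ₐ[k] Matrix (Fin 2) (Fin 2) L where
  toFun x := !![algebraMap k L (χ x), 0; 0, x]
  map_one' := by simp [Matrix.one_fin_two]
  map_mul' x y := by
    rw [Matrix.mul_fin_two, map_mul, map_mul]
    simp only [mul_zero, zero_mul, add_zero, zero_add]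
  map_zero' := by
    ext i j : 2
    fin_cases i <;> fin_cases j <;> simp
  map_add' x y := by
    ext i j : 2
    fin_cases i <;> fin_cases j <;> simp
  commutes' r := by
    ext i j : 2
    fin_cases i <;> fin_cases j <;> simp [Matrix.algebraMap_matrix_apply]

/-- The matrix with the given entry in the upper right corner and zeros elsewhere. -/
def corner {L : Type u} [Ring L] (a : L) : Matrix (Fin 2) (Fin 2) L := !![0, a; 0, 0]

section Corner

variable {L : Type u} [Ring L] (a b : L)

theorem corner_eq_zero_iff : corner a = 0 ↔ a = 0 := by
  constructor
  · intro h
    exact congrFun (congrFun h 0) 1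
  · rintro rfl
    ext i j : 2
    fin_cases i <;> fin_cases j <;> rfl

theorem corner_mul_corner : corner a * corner b = 0 := by
  rw [corner, corner, Matrix.mul_fin_two]
  simp only [mul_zero, zero_mul, add_zero]
  exact (corner_eq_zero_iff (0 : L)).2 rfl

variable [Algebra k L] (χ : L →ₐ[k] k) (x : L)

theorem diagHom_mul_corner : diagHom χ x * corner a = corner (algebraMap k L (χ x) * a) := by
  change !![_, _; _, _] * corner a = _
  rw [corner, corner, Matrix.mul_fin_two]
  simp only [mul_zero, zero_mul, add_zero]

theorem corner_mul_diagHom : corner a * diagHom χ x = corner (a * x) := by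
  change corner a * !![_, _; _, _] = _
  rw [corner, corner, Matrix.mul_fin_two]
  simp only [mul_zero, zero_mul, add_zero, zero_add]

end Corner

open Classical in
/-- The values of a representation of the glued algebra that detects the given new arrow. -/
noncomputable def detectValues (hIA : IsAdmissible IA) (hIB : IsAdmissible IB)
    (i : NewArrow J K) : GlueValues J K IA IB
      (Matrix (Fin 2) (Fin 2) (BoundQuiverAlgebra IA × BoundQuiverAlgebra IB)) where
  -- In these triangular matrices the corner is a bimodule: on the left A × B acts by scalars
  -- through the character at the source of `i`, on the right by multiplication. It thus models the
  -- right ideal generated by `i`, with `i` itself sent to the idempotent at its target.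
  hom := diagHom (char hIA hIB i.src)
  elem j := if j = i then corner (vertexProd IA IB i.tgt) else 0
  vertex_mul_elem j := by
    split_ifs with h
    · rw [h, diagHom_mul_corner, char_vertexProd_self, map_one, one_mul]
    · exact mul_zero _
  elem_mul_vertex j := by
    split_ifs with h
    · rw [h, corner_mul_diagHom, vertexProd_mul_self]
    · exact zero_mul _
  left_mul_elem f j := by
    split_ifs with h
    · rw [diagHom_mul_corner, char_arrow_left, map_zero, zero_mul, corner_eq_zero_iff]
    · exact mul_zero _
  right_mul_elem g j := by
    split_ifs with h
    · rw [diagHom_mul_corner, char_arrow_right, map_zero, zero_mul, corner_eq_zero_iff]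
    · exact mul_zero _
  elem_mul_elem j l := by
    split_ifs
    · exact corner_mul_corner _ _
    all_goals simp only [mul_zero, zero_mul]

variable [∀ a b, Finite (J a b)] [∀ b a, Finite (K b a)]

noncomputable instance : Fintype (NewArrow J K) := Fintype.ofFinite _

/-- The representation detecting `i` kills all other new arrows, and the corner entry of the image
of the sum is the asserted product. This is the independence of the right ideals generated by the
new arrows. -/
theorem vertexProd_mul_eq_zero (hIA : IsAdmissible IA) (hIB : IsAdmissible IB)
    (l : NewArrow J K → BoundQuiverAlgebra IA × BoundQuiverAlgebra IB)
    (h : ∑ i, i.elem IA IB * incl J K IA IB (l i) = 0) (i : NewArrow J K) :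
    vertexProd IA IB i.tgt * l i = 0 := by
  have h1 := congrArg (detectValues hIA hIB i).lift h
  simp only [map_sum, map_mul, GlueValues.lift_elem, GlueValues.lift_incl, map_zero] at h1
  rw [Finset.sum_eq_single i (fun j _ hj => ?_) fun h => absurd (Finset.mem_univ i) h] at h1
  · simp only [detectValues, if_pos, corner_mul_diagHom] at h1
    exact (corner_eq_zero_iff _).1 h1
  · simp only [detectValues, if_neg hj, zero_mul]

/-- The expressions on the right contain the trivial paths and are stable under appending an arrow:
an old one multiplies the coefficients, a new one kills the sum and leaves a scalar multiple of
itself. -/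
theorem exists_eq_incl_add_sum (hIA : IsAdmissible IA) (hIB : IsAdmissible IB)
    (c : BoundQuiverAlgebra (ideal J K IA IB)) :
    ∃ x, ∃ l : NewArrow J K → BoundQuiverAlgebra IA × BoundQuiverAlgebra IB,
      c = incl J K IA IB x + ∑ i, i.elem IA IB * incl J K IA IB (l i) := by
  classical
  obtain ⟨c, rfl⟩ := proj_surjective _ c
  induction c using induction_linear with
  | h0 => exact ⟨0, 0, by simp⟩
  | hadd c d hc hd =>
    obtain ⟨x, l, hc⟩ := hc
    obtain ⟨y, m, hd⟩ := hd
    refine ⟨x + y, l + m, ?_⟩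
    simp only [map_add, hc, hd, Pi.add_apply, mul_add, Finset.sum_add_distrib]
    exact add_add_add_comm _ _ _ _
  | hpath r a b p =>
    suffices h : ∃ x, ∃ l : NewArrow J K → BoundQuiverAlgebra IA × BoundQuiverAlgebra IB,
        proj (ideal J K IA IB) (ofPath p) =
          incl J K IA IB x + ∑ i, i.elem IA IB * incl J K IA IB (l i) by
      obtain ⟨x, l, h⟩ := h
      refine ⟨r • x, r • l, ?_⟩
      simp only [map_smul, h, Pi.smul_apply, mul_smul_comm, ← Finset.smul_sum, smul_add]
    have hold (y) (x) (l : NewArrow J K → BoundQuiverAlgebra IA × BoundQuiverAlgebra IB) :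
        (incl J K IA IB x + ∑ i, i.elem IA IB * incl J K IA IB (l i)) * incl J K IA IB y =
          incl J K IA IB (x * y) + ∑ i, i.elem IA IB * incl J K IA IB (l i * y) := by
      simp only [add_mul, map_mul, Finset.sum_mul, mul_assoc]
    have hnew (j : NewArrow J K) (x)
        (l : NewArrow J K → BoundQuiverAlgebra IA × BoundQuiverAlgebra IB) :
        (incl J K IA IB x + ∑ i, i.elem IA IB * incl J K IA IB (l i)) * j.elem IA IB =
          incl J K IA IB 0 + ∑ i, i.elem IA IB * incl J K IA IB
            (if i = j then algebraMap k _ (char hIA hIB j.src x) else 0) := by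
      rw [add_mul, Finset.sum_mul, Finset.sum_eq_zero fun i _ =>
        elem_mul_incl_mul_elem hIA hIB i j (l i), add_zero, incl_mul_elem hIA hIB, map_zero,
        zero_add, Finset.sum_eq_single j]
      · rw [if_pos rfl, AlgHom.commutes, ← Algebra.commutes, Algebra.smul_def]
      · intro i _ hi
        rw [if_neg hi, map_zero, mul_zero]
      · simp
    have harrow {x y : Glue J K} (f : Arrow x y) :
        (∃ z, proj (ideal J K IA IB) (Glue.arrow k f) = incl J K IA IB z) ∨
          ∃ j : NewArrow J K, proj (ideal J K IA IB) (Glue.arrow k f) = j.elem IA IB := by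
      cases f with
      | left f => exact .inl ⟨_, (incl_arrow_left IA IB f).symm⟩
      | right g => exact .inl ⟨_, (incl_arrow_right IA IB g).symm⟩
      | alpha j => exact .inr ⟨.inl ⟨_, _, j⟩, rfl⟩
      | beta l => exact .inr ⟨.inr ⟨_, _, l⟩, rfl⟩
    induction p with
    | nil => exact ⟨vertexProd IA IB a, 0, by simp [incl_vertexProd]⟩
    | cons p f ih =>
      obtain ⟨x, l, h⟩ := ih
      rw [ofPath_cons, map_mul, h]
      rcases harrow f with ⟨y, hy⟩ | ⟨j, hj⟩
      · exact ⟨_, _, (congrArg _ hy).trans (hold y x l)⟩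
      · exact ⟨_, _, (congrArg _ hj).trans (hnew j x l)⟩

theorem exists_eq_sum_of_retraction_eq_zero (hIA : IsAdmissible IA) (hIB : IsAdmissible IB)
    {c : BoundQuiverAlgebra (ideal J K IA IB)} (hc : retraction J K IA IB c = 0) :
    ∃ l : NewArrow J K → BoundQuiverAlgebra IA × BoundQuiverAlgebra IB,
      c = ∑ i, i.elem IA IB * incl J K IA IB (l i) := by
  obtain ⟨x, l, rfl⟩ := exists_eq_incl_add_sum hIA hIB c
  have hx : x = 0 := by
    simpa only [map_add, map_sum, map_mul, retraction_incl, retraction_elem, zero_mul,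
      Finset.sum_const_zero, add_zero] using hc
  exact ⟨l, by rw [hx, map_zero, zero_add]⟩

theorem mul_eq_zero_of_retraction_eq_zero (hIA : IsAdmissible IA) (hIB : IsAdmissible IB)
    (s t : BoundQuiverAlgebra (ideal J K IA IB)) (hs : retraction J K IA IB s = 0)
    (ht : retraction J K IA IB t = 0) : s * t = 0 := by
  obtain ⟨l, rfl⟩ := exists_eq_sum_of_retraction_eq_zero hIA hIB hs
  obtain ⟨m, rfl⟩ := exists_eq_sum_of_retraction_eq_zero hIA hIB ht
  simp only [Finset.sum_mul, Finset.mul_sum, ← mul_assoc, elem_mul_incl_mul_elem hIA hIB,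
    zero_mul, Finset.sum_const_zero]

/-- On a new arrow times an element of A × B, `C` acts from the left by scalars, through the
character at the source of the arrow; such products span the kernel. -/
theorem isSemisimpleModule_ker_retraction (hIA : IsAdmissible IA) (hIB : IsAdmissible IB) :
    IsSemisimpleModule (BoundQuiverAlgebra (ideal J K IA IB))
      (RingHom.ker (retraction J K IA IB).toRingHom) := by
  let Y : Set (BoundQuiverAlgebra (ideal J K IA IB)) :=
    {y | ∃ (i : NewArrow J K) (x : _), y = i.elem IA IB * incl J K IA IB x}
  have hss : IsSemisimpleModule (BoundQuiverAlgebra (ideal J K IA IB))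
      (Submodule.span (BoundQuiverAlgebra (ideal J K IA IB)) Y) := by
    refine isSemisimpleModule_span_of_smul_mem_line k ?_
    rintro _ ⟨i, x, rfl⟩ c
    obtain ⟨y, l, rfl⟩ := exists_eq_incl_add_sum hIA hIB c
    refine ⟨char hIA hIB i.src y, ?_⟩
    rw [smul_eq_mul, ← mul_assoc, add_mul, Finset.sum_mul, Finset.sum_eq_zero fun j _ =>
      elem_mul_incl_mul_elem hIA hIB j i (l j), add_zero, incl_mul_elem hIA hIB, smul_mul_assoc]
  refine isSemisimpleModule_of_le (T := Submodule.span _ Y) fun c hc => ?_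
  obtain ⟨l, rfl⟩ := exists_eq_sum_of_retraction_eq_zero hIA hIB ((RingHom.mem_ker).1 hc)
  exact sum_mem fun i _ => Submodule.subset_span ⟨i, l i, rfl⟩

/-- The generators are the new arrows, and the idempotents are those at their targets. -/
theorem isRightFlat_incl (hIA : IsAdmissible IA) (hIB : IsAdmissible IB) :
    IsRightFlat (incl J K IA IB).toRingHom :=
  isRightFlat_of_generators (π := (retraction J K IA IB).toRingHom) retraction_incl
    (fun i : NewArrow J K => i.elem IA IB) (fun i => vertexProd IA IB i.tgt) retraction_elem
    (elem_mul_vertex IA IB) (fun _ => exists_eq_sum_of_retraction_eq_zero hIA hIB)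
    (vertexProd_mul_eq_zero hIA hIB)

theorem finite_of_isAdmissible [∀ a a' : V, Finite (a ⟶ a')] [∀ b b' : W, Finite (b ⟶ b')]
    (hIA : IsAdmissible IA) (hIB : IsAdmissible IB) :
    Module.Finite k (BoundQuiverAlgebra (ideal J K IA IB)) := by
  have := BoundQuiverAlgebra.finite_of_isAdmissible hIA
  have := BoundQuiverAlgebra.finite_of_isAdmissible hIB
  let f : (BoundQuiverAlgebra IA × BoundQuiverAlgebra IB) ×
      (NewArrow J K → BoundQuiverAlgebra IA × BoundQuiverAlgebra IB) →ₗ[k]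
        BoundQuiverAlgebra (ideal J K IA IB) :=
    (incl J K IA IB).toLinearMap.coprod (∑ i : NewArrow J K,
      LinearMap.mulLeft k (i.elem IA IB) ∘ₗ (incl J K IA IB).toLinearMap ∘ₗ LinearMap.proj i)
  refine Module.Finite.of_surjective f fun c => ?_
  obtain ⟨x, l, rfl⟩ := exists_eq_incl_add_sum hIA hIB c
  refine ⟨(x, l), ?_⟩
  simp [f]

end Glue

/-- Finiteness and a bound for the finitistic dimension of `Cᵒᵖ`, where `A = k Q_A / I_A`,
`B = k Q_B / I_B`, and `C = k Q_C / I_C` is obtained by gluing with arrows in both directions. -/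
theorem proposition3p8 {k QA QB : Type u} [Field k]
    [Quiver.{u} QA] [Quiver.{u} QB] [Fintype QA] [Fintype QB]
    [∀ a a' : QA, Finite (a ⟶ a')] [∀ b b' : QB, Finite (b ⟶ b')]
    (J : QA → QB → Type u) (K : QB → QA → Type u)
    [∀ a b, Finite (J a b)] [∀ b a, Finite (K b a)]
    (IA : TwoSidedIdeal (PathAlgebra k QA)) (IB : TwoSidedIdeal (PathAlgebra k QB))
    (hIA : IsAdmissible IA) (hIB : IsAdmissible IB)
    (hA : findimOp (BoundQuiverAlgebra IA) < ⊤) (hB : findimOp (BoundQuiverAlgebra IB) < ⊤) :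
    findimOp (BoundQuiverAlgebra (Glue.ideal J K IA IB)) < ⊤ ∧
      findimOp (BoundQuiverAlgebra (Glue.ideal J K IA IB)) ≤
        max (max (findimOp (BoundQuiverAlgebra IA)) (findimOp (BoundQuiverAlgebra IB)))
          (findimOpSemisimple (BoundQuiverAlgebra (Glue.ideal J K IA IB))) + 1 := by
  have := Glue.finite_of_isAdmissible (J := J) (K := K) hIA hIB
  have : IsArtinianRing (BoundQuiverAlgebra (Glue.ideal J K IA IB)) := IsArtinianRing.of_finite k _
  have hC := findimOpSemisimple_lt_top (BoundQuiverAlgebra (Glue.ideal J K IA IB))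
  -- All three terms are finite, so the maximum is a natural number `d`, and one bound by `d + 1`
  -- yields both claims.
  obtain ⟨d, hd⟩ := ENat.ne_top_iff_exists.1 (max_lt (max_lt hA hB) hC).ne
  have := Glue.isSemisimpleModule_ker_retraction (J := J) (K := K) hIA hIB
  have h : findimOp (BoundQuiverAlgebra (Glue.ideal J K IA IB)) ≤ (d + 1 : ℕ) :=
    findimOp_le_of_splitting (π := (Glue.retraction J K IA IB).toRingHom)
      Glue.retraction_incl (Glue.mul_eq_zero_of_retraction_eq_zero hIA hIB)
      (Glue.isRightFlat_incl hIA hIB)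
      (hd ▸ (le_max_left _ _).trans (le_max_left _ _))
      (hd ▸ (le_max_right _ _).trans (le_max_left _ _)) (hd ▸ le_max_right _ _)
  refine ⟨h.trans_lt (ENat.natCast_lt_top _), ?_⟩
  rw [← hd]
  exact_mod_cast h
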